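/- For a topological space $E$ let $\mathrm{SM}(E)$ be the space of sup-measures on $E$, i.e. set functions $m$ from the open subsets of $E$ to $[0,\infty]$ with $m(\emptyset)=0$ and $m(\bigcup_i G_i)=\sup_i m(G_i)$ for every family of open sets, extended to all $A\subset E$ by $m(A)=\inf\{m(G): G\supset A \text{ open}\}$. It carries the sup-vague topology, the coarsest one for which $m\mapsto m(K)$ is upper semicontinuous for every compact $K$ and $m\mapsto m(G)$ is lower semicontinuous for every open $G$. Write $\Rightarrow$ for weak convergence of the laws of random elements (with respect to the Borel $\sigma$-algebra) of $\mathrm{SM}(E)$. Let $\alpha>0$. For $\beta\in(0,1)$ the Karlin random sup-measure on $\mathbb R$ is $$\mathcal M_{\alpha,\beta}(G)=\sup_{\ell}\Gamma_\ell^{-1/\alpha}\mathbf 1\{\widetilde{\mathcal N}_\ell(x_\ell G)\neq 0\},\qquad G\subset\mathbb R\text{ open},$$ where $\{(\Gamma_\ell,x_\ell,\widetilde{\mathcal N}_\ell)\}_{\ell}$ is a measurable enumeration of the points of a Poisson point process on $(0,\infty)\times(0,\infty)\times\mathfrak M_+(\mathbb R)$ with intensity $d\gamma\times\Gamma(1-\beta)^{-1}\beta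 x^{-\beta-1}dx\times d\widetilde{\mathbb P}$. Here $\mathfrak M_+(\mathbb R)$ is the space of Radon point measures on $\mathbb R$, and $\widetilde{\mathbb P}$ is the law of the Poisson random measure on $\mathbb R$ with Lebesgue intensity. The independently scattered sup-measure is $$\mathcal M_\alpha(G)=\sup_{\ell}\Gamma_\ell^{-1/\alpha}\mathbf 1\{U_\ell\in G\},$$ with $\{(\Gamma_\ell,U_\ell)\}_\ell$ a measurable enumeration of the points of a Poisson point process on $(0,\infty)\times\mathbb R$ with intensity $dx\,du$. The completely dependent one is $\mathcal M^{\rm c}_\alpha(\cdot)=Z\,\mathbf 1\{\cdot\neq\emptyset\}$, where $\mathbb P(Z\le z)=\exp(-z^{-\alpha})$ for $z>0$. **Proposition.** For every $\alpha>0$, $$\mathcal M_{\alpha,\beta}\Rightarrow\mathcal M_\alpha\quad\text{as }\beta\uparrow1,\qquad \mathcal M_{\alpha,\beta}\Rightarrow\mathcal M^{\rm c}_\alpha\quad\text{as }\beta\downarrow0,$$ both in $\mathrm{SM}(\mathbb R)$ and, for the restrictions to $[0,1]$ of all these random sup-measures, in $\mathrm{SM}([0,1])$. -/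

import Mathlib

open MeasureTheory ProbabilityTheory TopologicalSpace Filter Topology
open scoped ENNReal NNReal

/-! ### Sup-measures and the sup-vague topology -/

/-- The space `SM(E)` of sup-measures on a topological space `E`: set functions `m` from the open
sets of `E` to `[0, ∞]` such that `m (⋃ G_i) = sup m (G_i)` for every collection of open sets
(the empty collection gives `m ∅ = 0`). -/
abbrev SupMeasure (E : Type*) [TopologicalSpace E] : Type _ :=
  sSupHom (Opens E) ℝ≥0∞

namespace SupMeasure

variable {E : Type*} [TopologicalSpace E]

/-- The canonical extension of a sup-measure to all subsets: `m A = inf {m G | G open, A ⊆ G}`. -/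
noncomputable def extend (m : SupMeasure E) (A : Set E) : ℝ≥0∞ :=
  ⨅ (G : Opens E) (_ : A ⊆ (G : Set E)), m G

/-- The sup-vague topology: the coarsest topology for which `m ↦ m K` is upper semicontinuous for
all compact `K` and `m ↦ m G` is lower semicontinuous for all open `G`. Thus `m_i → m` if and
only if `limsup m_i K ≤ m K` for all compact `K` and `liminf m_i G ≥ m G` for all open `G`. -/
instance : TopologicalSpace (SupMeasure E) :=
  TopologicalSpace.generateFrom
    ({U | ∃ (K : Set E) (b : ℝ≥0∞), IsCompact K ∧ U = {m : SupMeasure E | m.extend K < b}} ∪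
      {U | ∃ (G : Opens E) (a : ℝ≥0∞), U = {m : SupMeasure E | a < m G}})

instance : MeasurableSpace (SupMeasure E) := borel _

instance : BorelSpace (SupMeasure E) := ⟨rfl⟩

theorem extend_mono (m : SupMeasure E) {A B : Set E} (h : A ⊆ B) : m.extend A ≤ m.extend B :=
  le_iInf₂ fun G hG => iInf₂_le G (h.trans hG)

theorem extend_sUnion (m : SupMeasure E) (S : Set (Set E)) :
    m.extend (⋃₀ S) = ⨆ A ∈ S, m.extend A := by
  apply le_antisymm
  · refine le_of_forall_gt fun c hc => ?_
    obtain ⟨d, hd, hdc⟩ := exists_between hc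
    have h : ∀ A ∈ S, ∃ G : Opens E, A ⊆ (G : Set E) ∧ m G < d := by
      intro A hA
      have h1 : m.extend A < d := lt_of_le_of_lt (le_iSup₂ (f := fun A _ => m.extend A) A hA) hd
      simpa [extend, iInf_lt_iff] using h1
    choose! G hG hGd using h
    refine lt_of_le_of_lt ?_ hdc
    refine (iInf₂_le (sSup (G '' S)) ?_).trans ?_
    · intro x hx
      obtain ⟨A, hA, hxA⟩ := hx
      exact Opens.mem_sSup.2 ⟨G A, ⟨A, hA, rfl⟩, hG A hA hxA⟩
    · rw [map_sSup]
      refine sSup_le ?_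
      rintro _ ⟨_, ⟨A, hA, rfl⟩, rfl⟩
      exact (hGd A hA).le
  · exact iSup₂_le fun A hA => extend_mono m (Set.subset_sUnion_of_mem hA)

/-- The restriction of a sup-measure to a subset `S`, evaluating the canonical extension at the
relatively open subsets of `S`. -/
noncomputable def restrict (S : Set E) (m : SupMeasure E) : SupMeasure S where
  toFun G := m.extend (Subtype.val '' (G : Set S))
  map_sSup' s := by
    have h : (Subtype.val '' ((sSup s : Opens S) : Set S) : Set E) =
        ⋃₀ ((fun G : Opens S => (Subtype.val '' (G : Set S) : Set E)) '' s) := by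
      ext x
      simp only [Opens.coe_sSup, Set.image_iUnion, Set.mem_iUnion, Set.sUnion_image]
    rw [h, extend_sUnion, sSup_image, iSup_image]

/-- The sup-measure `G ↦ sup_ℓ v_ℓ 1{hit_ℓ G}`, for weights `v_ℓ ∈ [0, ∞]` and relations `hit_ℓ`
compatible with unions. The supremum runs over those `ℓ` with `hit_ℓ G`, and it is `0` if
there is none. -/
noncomputable def ofHits (v : ℕ → ℝ≥0∞) (hit : ℕ → Opens E → Prop)
    (h : ∀ l (s : Set (Opens E)), hit l (sSup s) ↔ ∃ G ∈ s, hit l G) : SupMeasure E where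
  toFun G := ⨆ (l : ℕ) (_ : hit l G), v l
  map_sSup' s := by
    rw [sSup_image]
    apply le_antisymm
    · refine iSup₂_le fun l hl => ?_
      obtain ⟨G, hG, hlG⟩ := (h l s).1 hl
      exact (le_iSup₂ (f := fun (l : ℕ) (_ : hit l G) => v l) l hlG).trans
        (le_iSup₂ (f := fun (G : Opens E) (_ : G ∈ s) => ⨆ (l : ℕ) (_ : hit l G), v l) G hG)
    · refine iSup₂_le fun G hG => iSup₂_le fun l hl => ?_
      exact le_iSup₂ (f := fun (l : ℕ) (_ : hit l (sSup s)) => v l) l ((h l s).2 ⟨G, hG, hl⟩)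

/-- The completely dependent sup-measure `G ↦ z 1{G ≠ ∅}`. -/
noncomputable def completelyDependent (E : Type*) [TopologicalSpace E] (z : ℝ≥0∞) :
    SupMeasure E :=
  ofHits (fun _ => z) (fun _ G => (G : Set E).Nonempty) (by
    intro _ s
    constructor
    · rintro ⟨x, hx⟩
      obtain ⟨G, hG, hxG⟩ := Opens.mem_sSup.1 hx
      exact ⟨G, hG, x, hxG⟩
    · rintro ⟨G, hG, x, hxG⟩
      exact ⟨x, Opens.mem_sSup.2 ⟨G, hG, hxG⟩⟩)

/-- The sup-measure `G ↦ sup_ℓ γ_ℓ^{-1/α} 1{u_ℓ ∈ G}` on `ℝ`, for points `(γ_ℓ, u_ℓ)`. -/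
noncomputable def scattered (α : ℝ) (p : ℕ → ℝ × ℝ) : SupMeasure ℝ :=
  ofHits (fun l => ENNReal.ofReal (1 / (p l).1 ^ (1 / α))) (fun l G => (p l).2 ∈ G)
    (fun _ _ => Opens.mem_sSup)

end SupMeasure

/-! ### Poisson point processes -/

/-- Radon point measures on `E`: locally finite measures with values in `{0, 1, 2, …, ∞}`. The
measurable structure is the one generated by the evaluations `N ↦ N A`. -/
abbrev RadonPointMeasure (E : Type*) [TopologicalSpace E] [MeasurableSpace E] : Type _ :=
  {N : Measure E // IsLocallyFiniteMeasure N ∧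
    ∀ A : Set E, MeasurableSet A → N A = ∞ ∨ ∃ k : ℕ, N A = k}

/-- `η` is, under `P`, a Poisson random measure on `S` with intensity measure `μ`. -/
structure IsPoissonRandomMeasure {Ω S : Type*} [MeasurableSpace Ω] [MeasurableSpace S]
    (P : Measure Ω) (μ : Measure S) (η : Ω → Measure S) : Prop where
  measurable : Measurable η
  law_of_finite : ∀ A : Set S, MeasurableSet A → μ A ≠ ∞ →
    P.map (fun ω => η ω A) = (poissonMeasure (μ A).toNNReal).map (fun k : ℕ => (k : ℝ≥0∞))
  ae_eq_top_of_infinite : ∀ A : Set S, MeasurableSet A → μ A = ∞ → ∀ᵐ ω ∂P, η ω A = ∞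
  indep : ∀ (n : ℕ) (A : Fin n → Set S), (∀ i, MeasurableSet (A i)) →
    Pairwise (fun i j => Disjoint (A i) (A j)) → iIndepFun (fun i ω => η ω (A i)) P

/-- The random points `X_0, X_1, …` are a measurable enumeration of the points of a Poisson point
process on `S` with intensity measure `μ`. -/
structure IsPoissonEnumeration {Ω S : Type*} [MeasurableSpace Ω] [MeasurableSpace S]
    (P : Measure Ω) (μ : Measure S) (X : ℕ → Ω → S) : Prop where
  measurable : ∀ l, Measurable (X l)
  poisson : IsPoissonRandomMeasure P μ (fun ω => Measure.sum fun l => Measure.dirac (X l ω))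

/-! ### Karlin random sup-measures and their limits -/

/-- The measure `Γ(1-β)⁻¹ β x^{-β-1} dx` on `(0, ∞)`. -/
noncomputable def karlinScaleMeasure (β : ℝ) : Measure ℝ :=
  (volume.restrict (Set.Ioi 0)).withDensity
    (fun x => ENNReal.ofReal ((Real.Gamma (1 - β))⁻¹ * β * x ^ (-β - 1)))

/-- The intensity measure `dγ × Γ(1-β)⁻¹ β x^{-β-1} dx × d𝐏` of the Poisson point process that
defines the Karlin random sup-measure, `𝐏` being a law of point measures. -/
noncomputable def karlinIntensity (β : ℝ) (Pt : Measure (RadonPointMeasure ℝ)) :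
    Measure (ℝ × ℝ × RadonPointMeasure ℝ) :=
  (volume.restrict (Set.Ioi 0)).prod ((karlinScaleMeasure β).prod Pt)

theorem measure_scaled_sSup_ne_zero_iff (N : Measure ℝ) (x : ℝ) (s : Set (Opens ℝ)) :
    N ((fun y => x * y) '' ((sSup s : Opens ℝ) : Set ℝ)) ≠ 0 ↔
      ∃ G ∈ s, N ((fun y => x * y) '' (G : Set ℝ)) ≠ 0 := by
  constructor
  · intro h
    by_contra! hc
    apply h
    obtain ⟨T, hTc, hTs, hT⟩ := isOpen_sUnion_countable
      ((fun G : Opens ℝ => (G : Set ℝ)) '' s) (by rintro _ ⟨G, _, rfl⟩; exact G.isOpen)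
    have h1 : ((sSup s : Opens ℝ) : Set ℝ) = ⋃₀ T := by
      rw [hT, Set.sUnion_image, Opens.coe_sSup]
    rw [h1, Set.sUnion_eq_biUnion, Set.image_iUnion₂]
    refine (measure_biUnion_null_iff hTc).2 fun t ht => ?_
    obtain ⟨G, hG, rfl⟩ := hTs ht
    exact hc G hG
  · rintro ⟨G, hG, h⟩ h0
    refine h (measure_mono_null (Set.image_mono ?_) h0)
    exact (le_sSup hG : G ≤ sSup s)

/-- The sup-measure `G ↦ sup_ℓ γ_ℓ^{-1/α} 1{N_ℓ(x_ℓ G) ≠ 0}` on `ℝ`, for points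
`(γ_ℓ, x_ℓ, N_ℓ)`, where `x G = {x y | y ∈ G}`. -/
noncomputable def karlinSupMeasure (α : ℝ) (p : ℕ → ℝ × ℝ × RadonPointMeasure ℝ) :
    SupMeasure ℝ :=
  SupMeasure.ofHits (fun l => ENNReal.ofReal (1 / (p l).1 ^ (1 / α)))
    (fun l G => (p l).2.2.1 ((fun y => (p l).2.1 * y) '' (G : Set ℝ)) ≠ 0)
    (fun l s => measure_scaled_sSup_ne_zero_iff (p l).2.2.1 (p l).2.1 s)

/-- `Z` is a standard `α`-Fréchet random variable under `P`. -/
structure IsStandardFrechet {Ω : Type*} [MeasurableSpace Ω] (P : Measure Ω) (α : ℝ) (Z : Ω → ℝ) :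
    Prop where
  measurable : Measurable Z
  cdf : ∀ z : ℝ, 0 < z → P {ω | Z ω ≤ z} = ENNReal.ofReal (Real.exp (-z ^ (-α)))

/-! Everything reduces to joint distribution functions at finitely many pairs (A_i, z_i). The event
M(A_i) ≤ z_i for all i says that the Poisson process has no point whose weight γ^{-1/α} exceeds some
z_i while the point hits A_i. For fixed γ, only the union U_γ of the sets A_i with z_i < γ^{-1/α}
matters. In the Karlin case, the mass of the pairs (x, N) with N(xU) ≠ 0 is Γ(1-β)⁻¹ ∫ (1 -
e^{-x|U|}) β x^{-β-1} dx = |U|^β, so the probability is exp(-∫ |U_γ|^β dγ).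

For the scattered sup-measure the same formula holds with exponent 1. For the completely dependent
one, |U|^β is replaced by the indicator of U ≠ ∅, which is the limit of |U|^β as β ↓ 0, because a
nonempty open set has positive length. Since U_γ is empty for large γ and |U_γ| is bounded,
dominated convergence yields both limits at every level (`tendsto_cdf_of_tendsto_rpow`).

To pass to weak convergence, consider boxes, given by finitely many conditions m A ≤ z or z < m A.
Their probabilities are differences of joint distribution functions, they are closed under
intersection, and every open set contains a box neighbourhood of each of its points. As the
sup-vague topology is second countable, this suffices (`tendstoInDistribution_of_tendsto_cdf`).

On [0,1] the endpoints are almost surely not atoms, so the Karlin and scattered sup-measures may be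
evaluated on the part of a set in (0,1), which reduces this case to the line. -/

/-- In a locally compact regular second countable space there are countably many relatively compact
open sets that can be interpolated between any compact set and any open neighbourhood of it. -/
theorem exists_countable_opens_between (E : Type*) [TopologicalSpace E] [LocallyCompactSpace E]
    [RegularSpace E] [SecondCountableTopology E] :
    ∃ C : Set (Opens E), C.Countable ∧ (∀ A ∈ C, IsCompact (closure (A : Set E))) ∧
      ∀ K U : Set E, IsCompact K → IsOpen U → K ⊆ U →
        ∃ A ∈ C, K ⊆ (A : Set E) ∧ closure (A : Set E) ⊆ U := by
  obtain ⟨b, hbc, -, hb⟩ := exists_countable_basis E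
  let D : Set (Opens E) := {A | (A : Set E) ∈ b ∧ IsCompact (closure (A : Set E))}
  have hD : D.Countable := (hbc.preimage SetLike.coe_injective).mono fun A hA => hA.1
  refine ⟨sSup '' {T | T.Finite ∧ T ⊆ D}, (Set.countable_ofPred_finite_subset hD).image _, ?_, ?_⟩
  · rintro _ ⟨T, ⟨hT, hTD⟩, rfl⟩
    rw [Opens.coe_sSup, hT.closure_biUnion]
    exact hT.isCompact_biUnion fun A hA => (hTD hA).2
  · intro K U hK hU hKU
    refine hK.induction_on (p := fun S => ∃ A ∈ sSup '' {T | T.Finite ∧ T ⊆ D},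
      S ⊆ (A : Set E) ∧ closure (A : Set E) ⊆ U) ?_ ?_ ?_ ?_
    · exact ⟨_, ⟨∅, ⟨Set.finite_empty, Set.empty_subset _⟩, rfl⟩, by simp, by simp⟩
    · rintro S S' h ⟨A, hA, h1, h2⟩
      exact ⟨A, hA, h.trans h1, h2⟩
    · rintro S S' ⟨_, ⟨T, ⟨hT, hTD⟩, rfl⟩, h1, h2⟩ ⟨_, ⟨T', ⟨hT', hTD'⟩, rfl⟩, h1', h2'⟩
      refine ⟨_, ⟨T ∪ T', ⟨hT.union hT', Set.union_subset hTD hTD'⟩, rfl⟩, ?_, ?_⟩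
      · rw [sSup_union, Opens.coe_sup]
        exact Set.union_subset_union h1 h1'
      · rw [sSup_union, Opens.coe_sup, closure_union]
        exact Set.union_subset h2 h2'
    · intro x hx
      obtain ⟨V, hV, hxV, hVU, hVc⟩ := exists_open_between_and_isCompact_closure
        (isCompact_singleton (x := x)) hU (by simpa using hKU hx)
      obtain ⟨s, hs, hxs, hsV⟩ := hb.exists_subset_of_mem_open (hxV rfl) hV
      refine ⟨s, mem_nhdsWithin_of_mem_nhds ((hb.isOpen hs).mem_nhds hxs),
        _, ⟨{⟨s, hb.isOpen hs⟩}, ⟨Set.finite_singleton _, ?_⟩, rfl⟩, ?_, ?_⟩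
      · rintro _ rfl
        exact ⟨hs, hVc.of_isClosed_subset isClosed_closure (closure_mono hsV)⟩
      · simp
      · simpa using (closure_mono hsV).trans hVU

/-! ### Subbases and box neighbourhoods of the sup-vague topology. -/

namespace SupMeasure

section Topology

variable {E : Type*} [TopologicalSpace E]

theorem extend_coe (m : SupMeasure E) (G : Opens E) : m.extend (G : Set E) = m G :=
  le_antisymm (iInf₂_le G Set.Subset.rfl) (le_iInf₂ fun _ h => OrderHomClass.mono m h)

theorem extend_lt_iff {m : SupMeasure E} {A : Set E} {b : ℝ≥0∞} :
    m.extend A < b ↔ ∃ G : Opens E, A ⊆ (G : Set E) ∧ m G < b := by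
  simp [extend, iInf_lt_iff]

theorem isOpen_setOf_extend_lt {K : Set E} (hK : IsCompact K) (b : ℝ≥0∞) :
    IsOpen {m : SupMeasure E | m.extend K < b} :=
  isOpen_generateFrom_of_mem (Or.inl ⟨K, b, hK, rfl⟩)

theorem isOpen_setOf_lt_apply (G : Opens E) (a : ℝ≥0∞) : IsOpen {m : SupMeasure E | a < m G} :=
  isOpen_generateFrom_of_mem (Or.inr ⟨G, a, rfl⟩)

theorem measurableSet_setOf_lt_apply (G : Opens E) (a : ℝ≥0∞) :
    MeasurableSet {m : SupMeasure E | a < m G} :=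
  (isOpen_setOf_lt_apply G a).measurableSet

theorem measurableSet_setOf_apply_le (G : Opens E) (a : ℝ≥0∞) :
    MeasurableSet {m : SupMeasure E | m G ≤ a} := by
  have h : {m : SupMeasure E | m G ≤ a} = {m : SupMeasure E | a < m G}ᶜ := by ext; simp
  rw [h]
  exact (measurableSet_setOf_lt_apply G a).compl

/-- Evaluations at opens are approximated from inside, along an interpolating family. -/
theorem exists_lt_apply_of_lt {C : Set (Opens E)}
    (hC : ∀ K U : Set E, IsCompact K → IsOpen U → K ⊆ U →
        ∃ A ∈ C, K ⊆ (A : Set E) ∧ closure (A : Set E) ⊆ U)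
    {m : SupMeasure E} {G : Opens E} {a : ℝ≥0∞} (h : a < m G) :
    ∃ A ∈ C, closure (A : Set E) ⊆ (G : Set E) ∧ a < m A := by
  have hG : G = sSup {A | A ∈ C ∧ closure (A : Set E) ⊆ (G : Set E)} := by
    refine le_antisymm (fun x hx => ?_) (sSup_le fun A hA => subset_closure.trans hA.2)
    obtain ⟨A, hA, hxA, hAG⟩ := hC {x} G isCompact_singleton G.isOpen (by simpa using hx)
    exact Opens.mem_sSup.2 ⟨A, ⟨hA, hAG⟩, hxA rfl⟩
  rw [hG, map_sSup, lt_sSup_iff] at h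
  obtain ⟨_, ⟨A, hA, rfl⟩, h⟩ := h
  exact ⟨A, hA.1, hA.2, h⟩

/-- A countable subbasis of the sup-vague topology. -/
theorem eq_generateFrom_of_interpolating {C : Set (Opens E)}
    (hCc : ∀ A ∈ C, IsCompact (closure (A : Set E)))
    (hC : ∀ K U : Set E, IsCompact K → IsOpen U → K ⊆ U →
        ∃ A ∈ C, K ⊆ (A : Set E) ∧ closure (A : Set E) ⊆ U)
    {D : Set ℝ≥0∞} (hD : Dense D) :
    instTopologicalSpace (E := E) = generateFrom
      (Set.image2 (fun (A : Opens E) b => {m : SupMeasure E | m.extend (closure (A : Set E)) < b})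
        C D ∪ Set.image2 (fun (A : Opens E) a => {m : SupMeasure E | a < m A}) C D) := by
  apply _root_.le_antisymm
  · refine le_generateFrom ?_
    rintro _ (⟨A, hA, b, -, rfl⟩ | ⟨A, hA, b, -, rfl⟩)
    · exact isOpen_setOf_extend_lt (hCc A hA) b
    · exact isOpen_setOf_lt_apply A b
  · refine le_generateFrom (t := generateFrom _) ?_
    rintro _ (⟨K, b, hK, rfl⟩ | ⟨G, a, rfl⟩)
    -- A strict bound at K already holds on an open G ⊇ K, and the interpolation inserts A with K ⊆
    -- A and closure A ⊆ G. Compact K may thus be replaced by closures of members of C.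
    · have h : {m : SupMeasure E | m.extend K < b} =
          ⋃₀ (Set.image2 (fun (A : Opens E) q =>
            {m : SupMeasure E | m.extend (closure (A : Set E)) < q})
            {A | A ∈ C ∧ K ⊆ (A : Set E)} {q | q ∈ D ∧ q ≤ b}) := by
        ext m
        constructor
        · intro hm
          obtain ⟨q, hqD, hq1, hq2⟩ := hD.exists_between hm
          obtain ⟨G, hKG, hG⟩ := extend_lt_iff.1 hq1
          obtain ⟨A, hA, hKA, hAG⟩ := hC K G hK G.isOpen hKG
          refine ⟨_, ⟨A, ⟨hA, hKA⟩, q, ⟨hqD, hq2.le⟩, rfl⟩, ?_⟩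
          exact extend_lt_iff.2 ⟨G, hAG, hG⟩
        · rintro ⟨_, ⟨A, ⟨hA, hKA⟩, q, ⟨hqD, hq⟩, rfl⟩, hm⟩
          exact ((extend_mono m (hKA.trans subset_closure)).trans_lt hm).trans_le hq
      rw [h]
      refine @isOpen_sUnion _ (generateFrom _) _ ?_
      rintro _ ⟨A, hA, q, hq, rfl⟩
      exact isOpen_generateFrom_of_mem (Or.inl ⟨A, hA.1, q, hq.1, rfl⟩)
    · have h : {m : SupMeasure E | a < m G} =
          ⋃₀ (Set.image2 (fun (A : Opens E) q => {m : SupMeasure E | q < m A})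
            {A | A ∈ C ∧ A ≤ G} {q | q ∈ D ∧ a ≤ q}) := by
        ext m
        constructor
        · intro hm
          obtain ⟨A, hA, hAG, hA'⟩ := exists_lt_apply_of_lt hC (Set.mem_ofPred_eq ▸ hm)
          obtain ⟨q, hqD, hq1, hq2⟩ := hD.exists_between hA'
          exact ⟨_, ⟨A, ⟨hA, subset_closure.trans hAG⟩, q, ⟨hqD, hq1.le⟩, rfl⟩, hq2⟩
        · rintro ⟨_, ⟨A, ⟨hA, hAG⟩, q, ⟨hqD, hq⟩, rfl⟩, hm⟩
          exact (hq.trans_lt hm).trans_le (OrderHomClass.mono m hAG)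
      rw [h]
      refine @isOpen_sUnion _ (generateFrom _) _ ?_
      rintro _ ⟨A, hA, q, hq, rfl⟩
      exact isOpen_generateFrom_of_mem (Or.inr ⟨A, hA.1, q, hq.1, rfl⟩)

/-- The sets of sup-measures given by finitely many conditions `m A ≤ z` and `z < m A`. -/
def box (s t : Finset (Opens E × ℝ≥0∞)) : Set (SupMeasure E) :=
  {m | (∀ p ∈ s, m p.1 ≤ p.2) ∧ ∀ p ∈ t, p.2 < m p.1}

/-- The conditions that are used to test convergence in distribution: a relatively compact open
set together with a level in `(0, ∞)`. -/
def IsTest (p : Opens E × ℝ≥0∞) : Prop :=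
  IsCompact (closure (p.1 : Set E)) ∧ p.2 ≠ 0 ∧ p.2 ≠ ∞

theorem measurableSet_box (s t : Finset (Opens E × ℝ≥0∞)) : MeasurableSet (box s t) := by
  have h : box s t = (⋂ p ∈ s, {m : SupMeasure E | m p.1 ≤ p.2}) ∩
      ⋂ p ∈ t, {m : SupMeasure E | p.2 < m p.1} := by
    ext; simp [box]
  rw [h]
  exact (s.measurableSet_biInter fun p _ => measurableSet_setOf_apply_le _ _).inter
    (t.measurableSet_biInter fun p _ => measurableSet_setOf_lt_apply _ _)

/-- A box need not be open, as m ↦ m A is only lower semicontinuous. Room between K and its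
neighbourhood makes it a neighbourhood nevertheless: if K ⊆ A and z < b, the open condition
m(closure A) < z implies m A ≤ z, which implies m K < b. Finite intersections of boxes are boxes, so
subbasic sets suffice. -/
theorem exists_box_mem_nhds [LocallyCompactSpace E] [RegularSpace E] {u : Set (SupMeasure E)} (hu : IsOpen u) :
    ∀ m ∈ u, ∃ s t : Finset (Opens E × ℝ≥0∞), (∀ p ∈ s, IsTest p) ∧ (∀ p ∈ t, IsTest p) ∧
      box s t ∈ 𝓝 m ∧ box s t ⊆ u := by
  classical
  have hC : ∀ K U : Set E, IsCompact K → IsOpen U → K ⊆ U →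
      ∃ A ∈ {A : Opens E | IsCompact (closure (A : Set E))},
        K ⊆ (A : Set E) ∧ closure (A : Set E) ⊆ U := by
    intro K U hK hU hKU
    obtain ⟨V, hV, hKV, hVU, hVc⟩ := exists_open_between_and_isCompact_closure hK hU hKU
    exact ⟨⟨V, hV⟩, hVc, hKV, hVU⟩
  induction hu with
  | basic u hu =>
    intro m hm
    rcases hu with ⟨K, b, hK, rfl⟩ | ⟨G, a, rfl⟩
    · obtain ⟨z, hz1, hz2⟩ := exists_between (Set.mem_ofPred_eq ▸ hm)
      obtain ⟨G, hKG, hG⟩ := extend_lt_iff.1 hz1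
      obtain ⟨A, hA, hKA, hAG⟩ := hC K G hK G.isOpen hKG
      refine ⟨{(A, z)}, ∅, ?_, by simp, ?_, ?_⟩
      · simpa [IsTest] using ⟨hA, hG.ne_bot, hz2.ne_top⟩
      · refine mem_of_superset ((isOpen_setOf_extend_lt hA z).mem_nhds
          (extend_lt_iff.2 ⟨G, hAG, hG⟩)) fun m' hm' => ?_
        simp only [box, Finset.mem_singleton, forall_eq, Finset.notMem_empty, false_imp_iff,
          implies_true, and_true, Set.mem_ofPred_eq]
        rw [← extend_coe]
        exact (extend_mono m' subset_closure).trans (le_of_lt hm')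
      · intro m' hm'
        exact extend_lt_iff.2 ⟨A, hKA, (hm'.1 (A, z) (by simp)).trans_lt hz2⟩
    · obtain ⟨A, hA, hAG, hm'⟩ := exists_lt_apply_of_lt hC (Set.mem_ofPred_eq ▸ hm)
      obtain ⟨z, hz1, hz2⟩ := exists_between hm'
      refine ⟨∅, {(A, z)}, by simp, ?_, ?_, ?_⟩
      · simpa [IsTest] using ⟨hA, hz1.ne_bot, hz2.ne_top⟩
      · refine mem_of_superset ((isOpen_setOf_lt_apply A z).mem_nhds hz2) fun m' hm' => ?_
        simpa [box] using hm'
      · intro m' hm'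
        exact (hz1.trans (hm'.2 (A, z) (by simp))).trans_le
          (OrderHomClass.mono m' (subset_closure.trans hAG))
  | univ => exact fun m _ => ⟨∅, ∅, by simp, by simp, by simp [box], Set.subset_univ _⟩
  | inter u v _ _ hu hv =>
    intro m hm
    obtain ⟨s, t, hs, ht, h1, h2⟩ := hu m hm.1
    obtain ⟨s', t', hs', ht', h1', h2'⟩ := hv m hm.2
    refine ⟨s ∪ s', t ∪ t', ?_, ?_, ?_⟩
    · simp only [Finset.mem_union]; rintro p (h | h); exacts [hs p h, hs' p h]
    · simp only [Finset.mem_union]; rintro p (h | h); exacts [ht p h, ht' p h]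
    · have h : box (s ∪ s') (t ∪ t') = box s t ∩ box s' t' := by
        ext m; simp only [box, Finset.mem_union, Set.mem_inter_iff, Set.mem_ofPred_eq]; grind
      rw [h]
      exact ⟨inter_mem h1 h1', Set.inter_subset_inter h2 h2'⟩
  | sUnion T _ hT =>
    rintro m ⟨u, hu, hm⟩
    obtain ⟨s, t, hs, ht, h1, h2⟩ := hT u hu m hm
    exact ⟨s, t, hs, ht, h1, h2.trans (Set.subset_sUnion_of_mem hu)⟩

/-! ### Measurability and weak convergence from joint distribution functions. -/

variable [LocallyCompactSpace E] [RegularSpace E] [SecondCountableTopology E]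

instance : SecondCountableTopology (SupMeasure E) := by
  obtain ⟨C, hCn, hCc, hC⟩ := exists_countable_opens_between E
  obtain ⟨D, hDn, hD⟩ := TopologicalSpace.exists_countable_dense ℝ≥0∞
  exact ⟨_, (hCn.image2 hDn _).union (hCn.image2 hDn _), eq_generateFrom_of_interpolating hCc hC hD⟩

/-- A random sup-measure is measurable as soon as its values at relatively compact open sets are. -/
theorem aemeasurable_of_nullMeasurableSet {Ω : Type*} [MeasurableSpace Ω] {P : Measure Ω}
    {X : Ω → SupMeasure E}
    (h : ∀ A : Opens E, IsCompact (closure (A : Set E)) → ∀ z : ℝ≥0∞, z ≠ 0 → z ≠ ∞ →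
      NullMeasurableSet {ω | X ω A ≤ z} P) :
    AEMeasurable X P := by
  obtain ⟨C, hCn, hCc, hC⟩ := exists_countable_opens_between E
  obtain ⟨D, hDn, hD, hD0, hD1⟩ := ENNReal.exists_countable_dense_no_zero_top
  have hb : borel (SupMeasure E) = _ :=
    borel_eq_generateFrom_of_subbasis (eq_generateFrom_of_interpolating hCc hC hD)
  have hDz : ∀ {z}, z ∈ D → z ≠ 0 ∧ z ≠ ∞ :=
    fun hz => ⟨fun h => hD0 (h ▸ hz), fun h => hD1 (h ▸ hz)⟩
  -- Second countability makes the Borel σ-algebra countably generated, so null measurability, which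
  -- can be tested on the countable subbasis, is enough.
  refine NullMeasurable.aemeasurable ?_
  have key : ∀ U ∈ Set.image2 (fun (A : Opens E) b =>
      {m : SupMeasure E | m.extend (closure (A : Set E)) < b}) C D ∪
      Set.image2 (fun (A : Opens E) a => {m : SupMeasure E | a < m A}) C D,
      NullMeasurableSet (X ⁻¹' U) P := by
    rintro _ (⟨A, hA, b, -, rfl⟩ | ⟨A, hA, a, -, rfl⟩)
    · have h1 : X ⁻¹' {m : SupMeasure E | m.extend (closure (A : Set E)) < b} =
          ⋃ B ∈ {B : Opens E | B ∈ C ∧ closure (A : Set E) ⊆ (B : Set E)},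
            ⋃ z ∈ {z | z ∈ D ∧ z < b}, {ω | X ω B ≤ z} := by
        ext ω
        simp only [Set.mem_preimage, Set.mem_ofPred_eq, Set.mem_iUnion, exists_prop]
        constructor
        · intro hm
          obtain ⟨z, hzD, hz1, hz2⟩ := hD.exists_between hm
          obtain ⟨G, hKG, hG⟩ := extend_lt_iff.1 hz1
          obtain ⟨B, hB, hKB, hBG⟩ := hC _ G (hCc A hA) G.isOpen hKG
          exact ⟨B, ⟨hB, hKB⟩, z, ⟨hzD, hz2⟩,
            (OrderHomClass.mono (X ω) (show B ≤ G from subset_closure.trans hBG)).trans hG.le⟩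
        · rintro ⟨B, ⟨-, hAB⟩, z, ⟨-, hz⟩, hm⟩
          exact extend_lt_iff.2 ⟨B, hAB, hm.trans_lt hz⟩
      rw [h1]
      refine NullMeasurableSet.biUnion (hCn.mono fun _ h => h.1) fun B hB => ?_
      refine NullMeasurableSet.biUnion (hDn.mono fun _ h => h.1) fun z hz => ?_
      exact h B (hCc B hB.1) z (hDz hz.1).1 (hDz hz.1).2
    · have h1 : X ⁻¹' {m : SupMeasure E | a < m A} =
          ⋃ z ∈ {z | z ∈ D ∧ a ≤ z}, {ω | X ω A ≤ z}ᶜ := by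
        ext ω
        simp only [Set.mem_preimage, Set.mem_ofPred_eq, Set.mem_iUnion, exists_prop,
          Set.mem_compl_iff, not_le]
        constructor
        · intro hm
          obtain ⟨z, hzD, hz1, hz2⟩ := hD.exists_between hm
          exact ⟨z, ⟨hzD, hz1.le⟩, hz2⟩
        · rintro ⟨z, ⟨-, hz⟩, hm⟩
          exact hz.trans_lt hm
      rw [h1]
      refine NullMeasurableSet.biUnion (hDn.mono fun _ h => h.1) fun z hz => ?_
      exact (h A (hCc A hA) z (hDz hz.1).1 (hDz hz.1).2).compl
  have key' : @Measurable (NullMeasurableSpace Ω P) (SupMeasure E) _ (borel _) X := by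
    rw [hb]
    exact measurable_generateFrom key
  exact fun s hs => key' hs

/-- Random sup-measures converge in distribution as soon as their joint distribution functions at
relatively compact open sets converge at all positive finite levels. -/
theorem tendstoInDistribution_of_tendsto_cdf {ι : Type*} {l : Filter ι} [l.IsCountablyGenerated]
    {Ω : ι → Type*} [∀ i, MeasurableSpace (Ω i)] {P : ∀ i, Measure (Ω i)}
    [∀ i, IsProbabilityMeasure (P i)] {Ω' : Type*} [MeasurableSpace Ω'] {P' : Measure Ω'}
    [IsProbabilityMeasure P'] {X : ∀ i, Ω i → SupMeasure E} {Y : Ω' → SupMeasure E}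
    (hX : ∀ i, AEMeasurable (X i) (P i)) (hY : AEMeasurable Y P')
    (h : ∀ s : Finset (Opens E × ℝ≥0∞), (∀ p ∈ s, IsTest p) →
      Tendsto (fun i => P i {ω | ∀ p ∈ s, X i ω p.1 ≤ p.2}) l
        (𝓝 (P' {ω | ∀ p ∈ s, Y ω p.1 ≤ p.2}))) :
    TendstoInDistribution X l Y P P' := by
  classical
  refine ⟨hX, hY, ?_⟩
  set μ : ι → ProbabilityMeasure (SupMeasure E) :=
    fun i => ⟨(P i).map (X i), Measure.isProbabilityMeasure_map (hX i)⟩ with hμ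
  set ν : ProbabilityMeasure (SupMeasure E) := ⟨P'.map Y, Measure.isProbabilityMeasure_map hY⟩
    with hν
  have hbox : ∀ t : Finset (Opens E × ℝ≥0∞), (∀ p ∈ t, IsTest p) →
      ∀ s : Finset (Opens E × ℝ≥0∞), (∀ p ∈ s, IsTest p) →
      Tendsto (fun i => (μ i : Measure (SupMeasure E)).real (box s t)) l
        (𝓝 ((ν : Measure (SupMeasure E)).real (box s t))) := by
    intro t
    induction t using Finset.induction_on with
    | empty =>
      intro _ s hs
      refine (ENNReal.tendsto_toReal (measure_ne_top _ _)).comp ?_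
      have h1 : ((ν : Measure (SupMeasure E)) (box s ∅)) = P' {ω | ∀ p ∈ s, Y ω p.1 ≤ p.2} := by
        rw [hν, ProbabilityMeasure.coe_mk, Measure.map_apply_of_aemeasurable hY
          (measurableSet_box _ _)]
        simp [box]
      have h2 : ∀ i, ((μ i : Measure (SupMeasure E)) (box s ∅)) =
          P i {ω | ∀ p ∈ s, X i ω p.1 ≤ p.2} := by
        intro i
        rw [hμ, ProbabilityMeasure.coe_mk, Measure.map_apply_of_aemeasurable (hX i)
          (measurableSet_box _ _)]
        simp [box]
      simpa only [h1, h2] using h s hs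
    | insert p t hp ih =>
      intro ht s hs
      have ht' : ∀ p ∈ t, IsTest p := fun q hq => ht q (Finset.mem_insert_of_mem hq)
      have hsp : ∀ q ∈ insert p s, IsTest q := by
        intro q hq
        rcases Finset.mem_insert.1 hq with rfl | hq
        exacts [ht q (Finset.mem_insert_self _ _), hs q hq]
      -- A strict lower condition is traded for an upper one by complementation; the induction on t
      -- ends at boxes with upper conditions only, which are the joint distribution functions.
      have hd : box s (insert p t) = box s t \ box (insert p s) t := by
        ext m
        simp only [box, Finset.mem_insert, Set.mem_sdiff, Set.mem_ofPred_eq, forall_eq_or_imp]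
        constructor
        · rintro ⟨h1, h2, h3⟩
          exact ⟨⟨h1, h3⟩, fun h => (h2.trans_le h.1.1).false⟩
        · rintro ⟨⟨h1, h3⟩, h⟩
          refine ⟨h1, not_le.1 fun h2 => h ⟨⟨h2, h1⟩, h3⟩, h3⟩
      have hsub : box (insert p s) t ⊆ box s t :=
        fun m hm => ⟨fun q hq => hm.1 q (Finset.mem_insert_of_mem hq), hm.2⟩
      have h1 : ∀ ρ : ProbabilityMeasure (SupMeasure E),
          (ρ : Measure (SupMeasure E)).real (box s (insert p t)) =
            (ρ : Measure (SupMeasure E)).real (box s t) -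
              (ρ : Measure (SupMeasure E)).real (box (insert p s) t) := by
        intro ρ
        rw [hd, measureReal_sdiff hsub (measurableSet_box _ _)]
      simp only [h1]
      exact (ih ht' s hs).sub (ih ht' _ hsp)
  -- Convergence on a π-system that contains arbitrarily small neighbourhoods of every point implies
  -- weak convergence in a second countable space.
  refine IsPiSystem.tendsto_probabilityMeasure_of_tendsto_of_mem
    (S := {U | ∃ s t : Finset (Opens E × ℝ≥0∞), (∀ p ∈ s, IsTest p) ∧ (∀ p ∈ t, IsTest p) ∧
      U = box s t}) ?_ ?_ ?_ ?_
  · rintro _ ⟨s, t, hs, ht, rfl⟩ _ ⟨s', t', hs', ht', rfl⟩ -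
    refine ⟨s ∪ s', t ∪ t', ?_, ?_, ?_⟩
    · simp only [Finset.mem_union]; rintro p (h | h); exacts [hs p h, hs' p h]
    · simp only [Finset.mem_union]; rintro p (h | h); exacts [ht p h, ht' p h]
    · ext m; simp only [box, Finset.mem_union, Set.mem_inter_iff, Set.mem_ofPred_eq]; grind
  · rintro _ ⟨s, t, -, -, rfl⟩
    exact measurableSet_box s t
  · intro u hu m hm
    obtain ⟨s, t, hs, ht, h1, h2⟩ := exists_box_mem_nhds hu m hm
    exact ⟨_, ⟨s, t, hs, ht, rfl⟩, h1, h2⟩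
  · rintro _ ⟨s, t, hs, ht, rfl⟩
    refine NNReal.tendsto_coe.1 ?_
    simpa using hbox t ht s hs

end Topology

end SupMeasure

/-! ### Void probabilities -/

theorem IsPoissonRandomMeasure.measure_eq_zero {Ω S : Type*} [MeasurableSpace Ω]
    [MeasurableSpace S] {P : Measure Ω} {μ : Measure S} {η : Ω → Measure S}
    (h : IsPoissonRandomMeasure P μ η) {A : Set S} (hA : MeasurableSet A) (hμ : μ A ≠ ∞) :
    P {ω | η ω A = 0} = ENNReal.ofReal (Real.exp (-(μ A).toReal)) := by
  have h1 := congrArg (fun ρ : Measure ℝ≥0∞ => ρ {0}) (h.law_of_finite A hA hμ)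
  have hm : Measurable fun ω => η ω A := (Measure.measurable_coe hA).comp h.measurable
  have h2 : (fun k : ℕ => (k : ℝ≥0∞)) ⁻¹' {0} = {0} := by ext; simp
  simp only [Measure.map_apply hm (measurableSet_singleton _),
    Measure.map_apply (measurable_from_top (f := fun k : ℕ => (k : ℝ≥0∞)))
      (measurableSet_singleton _), h2, poissonMeasure_singleton] at h1
  simpa [Set.preimage, ENNReal.coe_toNNReal_eq_toReal] using h1

namespace IsPoissonEnumeration

variable {Ω S : Type*} [MeasurableSpace Ω] [MeasurableSpace S] {P : Measure Ω} {μ : Measure S}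
  {X : ℕ → Ω → S}

theorem measure_forall_notMem (h : IsPoissonEnumeration P μ X) {D : Set S} (hD : MeasurableSet D)
    (hμ : μ D ≠ ∞) :
    P {ω | ∀ l, X l ω ∉ D} = ENNReal.ofReal (Real.exp (-(μ D).toReal)) := by
  rw [← h.poisson.measure_eq_zero hD hμ]
  congr 1 with ω
  simp [Measure.sum_apply _ hD, Measure.dirac_apply' _ hD]

theorem ae_forall_notMem [IsProbabilityMeasure P] (h : IsPoissonEnumeration P μ X) {D : Set S}
    (hD : MeasurableSet D) (hμ : μ D = 0) : ∀ᵐ ω ∂P, ∀ l, X l ω ∉ D := by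
  have h1 := h.measure_forall_notMem hD (by simp [hμ])
  have h2 : MeasurableSet {ω | ∀ l, X l ω ∉ D} := by
    rw [Set.ofPred_forall]
    exact MeasurableSet.iInter fun l => (h.measurable l hD).compl
  rw [ae_iff, ← Set.compl_ofPred, prob_compl_eq_zero_iff h2, h1]
  simp [hμ]

end IsPoissonEnumeration

/-- Comparison of a level with a weight `γ ^ (-1/α)`. -/
theorem lt_ofReal_one_div_rpow_iff {α γ : ℝ} (hα : 0 < α) (hγ : 0 < γ) {z : ℝ≥0∞} (hz : z ≠ 0)
    (hz' : z ≠ ∞) :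
    z < ENNReal.ofReal (1 / γ ^ (1 / α)) ↔ γ < z.toReal ^ (-α) := by
  have hz0 : 0 < z.toReal := ENNReal.toReal_pos hz hz'
  have hg : 0 < γ ^ (1 / α) := Real.rpow_pos_of_pos hγ _
  rw [ENNReal.lt_ofReal_iff_toReal_lt hz', lt_one_div hz0 hg, Real.rpow_neg hz0.le,
    one_div, one_div, ← Real.inv_rpow hz0.le]
  exact Real.rpow_inv_lt_iff_of_pos hγ.le (inv_nonneg.2 hz0.le) hα

/-! ### Joint distribution functions as void probabilities. -/

namespace SupMeasure

variable {E : Type*} [TopologicalSpace E]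

/-- The union of those `A` among the pairs `(A, z)` in `s` for which `z < γ ^ (-1/α)`. -/
noncomputable def activeUnion (α : ℝ) (s : Finset (Opens E × ℝ≥0∞)) (γ : ℝ) : Opens E :=
  sSup {G | ∃ p ∈ s, p.2 < ENNReal.ofReal (1 / γ ^ (1 / α)) ∧ p.1 = G}

theorem coe_activeUnion (α : ℝ) (s : Finset (Opens E × ℝ≥0∞)) (γ : ℝ) :
    (activeUnion α s γ : Set E) =
      ⋃ p ∈ s, ⋃ (_ : p.2 < ENNReal.ofReal (1 / γ ^ (1 / α))), (p.1 : Set E) := by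
  ext x
  rw [activeUnion, SetLike.mem_coe, Opens.mem_sSup]
  simp only [Set.mem_iUnion]
  constructor
  · rintro ⟨_, ⟨p, hp, h, rfl⟩, hx⟩
    exact ⟨p, hp, h, hx⟩
  · rintro ⟨p, hp, h, hx⟩
    exact ⟨_, ⟨p, hp, h, rfl⟩, hx⟩

theorem ofHits_apply_le_iff {v : ℕ → ℝ≥0∞} {hit : ℕ → Opens E → Prop}
    {h : ∀ l (s : Set (Opens E)), hit l (sSup s) ↔ ∃ G ∈ s, hit l G} {G : Opens E} {z : ℝ≥0∞} :
    ofHits v hit h G ≤ z ↔ ∀ l, hit l G → v l ≤ z :=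
  iSup₂_le_iff

section Void

variable {Ω S : Type*} [MeasurableSpace Ω] [MeasurableSpace S] {P : Measure Ω}
  {ν : Measure S} {X : ℕ → Ω → ℝ × S}
  {α : ℝ} {hit : S → Opens E → Prop} {S₀ : Set S}

/-- The region of the point space that has to be void for the joint distribution function. -/
def voidRegion (α : ℝ) (hit : S → Opens E → Prop) (S₀ : Set S) (s : Finset (Opens E × ℝ≥0∞)) :
    Set (ℝ × S) :=
  ⋃ p ∈ s, (Set.Ioi 0 ∩ {γ | p.2 < ENNReal.ofReal (1 / γ ^ (1 / α))}) ×ˢ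
    {x | x ∈ S₀ ∧ hit x p.1}

theorem measurableSet_voidRegion (hm : ∀ G, MeasurableSet {x | x ∈ S₀ ∧ hit x G})
    (s : Finset (Opens E × ℝ≥0∞)) : MeasurableSet (voidRegion α hit S₀ s) := by
  refine s.measurableSet_biUnion fun p _ => MeasurableSet.prod ?_ (hm p.1)
  refine measurableSet_Ioi.inter (measurableSet_lt measurable_const ?_)
  fun_prop

theorem setOf_lt_weight_eq {α : ℝ} (hα : 0 < α) {z : ℝ≥0∞} (hz : z ≠ 0) (hz' : z ≠ ∞) :
    Set.Ioi 0 ∩ {γ : ℝ | z < ENNReal.ofReal (1 / γ ^ (1 / α))} =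
      Set.Ioo 0 (z.toReal ^ (-α)) := by
  ext γ
  simp only [Set.mem_inter_iff, Set.mem_Ioi, Set.mem_ofPred_eq, Set.mem_Ioo]
  exact and_congr_right fun hγ => lt_ofReal_one_div_rpow_iff hα hγ hz hz'

/-- Slice at γ: hitting one of the active sets is the same as hitting their union, because `hit` is
compatible with unions. So a whole family of constraints costs the mass of a single open set. -/
theorem prod_voidRegion [SFinite ν]
    (hhit : ∀ x (T : Set (Opens E)), hit x (sSup T) ↔ ∃ G ∈ T, hit x G)
    (hm : ∀ G, MeasurableSet {x | x ∈ S₀ ∧ hit x G}) (s : Finset (Opens E × ℝ≥0∞)) :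
    ((volume.restrict (Set.Ioi (0 : ℝ))).prod ν) (voidRegion α hit S₀ s) =
      ∫⁻ γ in Set.Ioi (0 : ℝ), ν {x | x ∈ S₀ ∧ hit x (activeUnion α s γ)} := by
  rw [Measure.prod_apply (measurableSet_voidRegion hm s)]
  refine setLIntegral_congr_fun measurableSet_Ioi fun γ hγ => ?_
  congr 1 with x
  simp only [voidRegion, activeUnion, hhit, Set.mem_preimage, Set.mem_iUnion, Set.mem_prod,
    Set.mem_inter_iff, Set.mem_ofPred_eq]
  constructor
  · rintro ⟨p, hp, ⟨-, h1⟩, h2, h3⟩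
    exact ⟨h2, _, ⟨p, hp, h1, rfl⟩, h3⟩
  · rintro ⟨h2, _, ⟨p, hp, h1, rfl⟩, h3⟩
    exact ⟨p, hp, ⟨hγ, h1⟩, h2, h3⟩

theorem prod_voidRegion_ne_top [SFinite ν] (hα : 0 < α) {s : Finset (Opens E × ℝ≥0∞)}
    (hs : ∀ p ∈ s, p.2 ≠ 0 ∧ p.2 ≠ ∞) (hfin : ∀ p ∈ s, ν {x | x ∈ S₀ ∧ hit x p.1} ≠ ∞) :
    ((volume.restrict (Set.Ioi (0 : ℝ))).prod ν) (voidRegion α hit S₀ s) ≠ ∞ := by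
  refine ((measure_biUnion_finset_le s _).trans_lt (ENNReal.sum_lt_top.2 fun p hp => ?_)).ne
  rw [setOf_lt_weight_eq hα (hs p hp).1 (hs p hp).2, Measure.prod_prod]
  exact ENNReal.mul_lt_top ((Measure.restrict_apply_le _ _).trans_lt measure_Ioo_lt_top)
    (hfin p hp).lt_top

variable [IsProbabilityMeasure P] [SFinite ν]

/-- Almost surely, the joint distribution function is determined by the void region. -/
theorem ofHits_le_ae_iff
    (hX : IsPoissonEnumeration P ((volume.restrict (Set.Ioi (0 : ℝ))).prod ν) X)
    (hhit : ∀ x (T : Set (Opens E)), hit x (sSup T) ↔ ∃ G ∈ T, hit x G)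
    (hS₀ : MeasurableSet S₀) (hν : ν S₀ᶜ = 0) :
    ∀ᵐ ω ∂P, ∀ s : Finset (Opens E × ℝ≥0∞),
      (∀ p ∈ s, ofHits (fun l => ENNReal.ofReal (1 / (X l ω).1 ^ (1 / α)))
        (fun l => hit (X l ω).2) (fun l => hhit (X l ω).2) p.1 ≤ p.2) ↔
      ∀ l, X l ω ∉ voidRegion α hit S₀ s := by
  have h0 : ((volume.restrict (Set.Ioi (0 : ℝ))).prod ν) (Set.Ioi 0 ×ˢ S₀)ᶜ = 0 := by
    rw [Set.compl_prod_eq_union]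
    refine measure_union_null ?_ ?_
    · rw [Measure.prod_prod, Measure.restrict_apply measurableSet_Ioi.compl,
        Set.compl_inter_self, measure_empty, zero_mul]
    · rw [Measure.prod_prod, hν, mul_zero]
  filter_upwards [hX.ae_forall_notMem (measurableSet_Ioi.prod hS₀).compl h0] with ω hω s
  simp only [Set.mem_compl_iff, not_not, Set.mem_prod] at hω
  simp only [ofHits_apply_le_iff, voidRegion, Set.mem_iUnion, not_exists, Set.mem_prod,
    Set.mem_inter_iff, Set.mem_ofPred_eq]
  constructor
  · rintro h l p hp ⟨⟨-, h1⟩, -, h2⟩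
    exact (h1.trans_le (h p hp l h2)).false
  · intro h p hp l h1
    by_contra h2
    exact h l p hp ⟨⟨(hω l).1, not_le.1 h2⟩, (hω l).2, h1⟩

/-- The event agrees with the measurable void event only off the null set on which some enumerated
point leaves (0, ∞) × S₀. The relation `hit` is controlled only on S₀, hence null measurability. -/
theorem nullMeasurableSet_ofHits_le
    (hX : IsPoissonEnumeration P ((volume.restrict (Set.Ioi (0 : ℝ))).prod ν) X)
    (hhit : ∀ x (T : Set (Opens E)), hit x (sSup T) ↔ ∃ G ∈ T, hit x G)
    (hS₀ : MeasurableSet S₀) (hν : ν S₀ᶜ = 0) (hm : ∀ G, MeasurableSet {x | x ∈ S₀ ∧ hit x G})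
    (s : Finset (Opens E × ℝ≥0∞)) :
    NullMeasurableSet {ω | ∀ p ∈ s, ofHits (fun l => ENNReal.ofReal (1 / (X l ω).1 ^ (1 / α)))
        (fun l => hit (X l ω).2) (fun l => hhit (X l ω).2) p.1 ≤ p.2} P := by
  have h2 : MeasurableSet {ω | ∀ l, X l ω ∉ voidRegion α hit S₀ s} := by
    rw [Set.ofPred_forall]
    exact MeasurableSet.iInter fun l => (hX.measurable l (measurableSet_voidRegion hm s)).compl
  refine h2.nullMeasurableSet.congr ?_
  filter_upwards [ofHits_le_ae_iff (α := α) hX hhit hS₀ hν] with ω hω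
  exact propext (hω s).symm

theorem measure_ofHits_le
    (hX : IsPoissonEnumeration P ((volume.restrict (Set.Ioi (0 : ℝ))).prod ν) X) (hα : 0 < α)
    (hhit : ∀ x (T : Set (Opens E)), hit x (sSup T) ↔ ∃ G ∈ T, hit x G)
    (hS₀ : MeasurableSet S₀) (hν : ν S₀ᶜ = 0) (hm : ∀ G, MeasurableSet {x | x ∈ S₀ ∧ hit x G})
    {s : Finset (Opens E × ℝ≥0∞)} (hs : ∀ p ∈ s, p.2 ≠ 0 ∧ p.2 ≠ ∞)
    (hfin : ∀ p ∈ s, ν {x | x ∈ S₀ ∧ hit x p.1} ≠ ∞) :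
    P {ω | ∀ p ∈ s, ofHits (fun l => ENNReal.ofReal (1 / (X l ω).1 ^ (1 / α)))
        (fun l => hit (X l ω).2) (fun l => hhit (X l ω).2) p.1 ≤ p.2} =
      ENNReal.ofReal (Real.exp (-(∫⁻ γ in Set.Ioi (0 : ℝ),
        ν {x | x ∈ S₀ ∧ hit x (activeUnion α s γ)}).toReal)) := by
  rw [← prod_voidRegion hhit hm s, ← hX.measure_forall_notMem (measurableSet_voidRegion hm s)
    (prod_voidRegion_ne_top hα hs hfin)]
  refine measure_congr ?_
  filter_upwards [ofHits_le_ae_iff (α := α) hX hhit hS₀ hν] with ω hω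
  exact propext (hω s)

end Void

end SupMeasure

/-! ### The intensities of the Karlin and of the scattered sup-measures -/

/-- Rewriting 1 - e^{-xb} as the integral of its derivative in b prepares an exchange of integrals
that leaves a Gamma integral in x. -/
theorem lintegral_mul_exp_neg_mul_Ioc {b x : ℝ} (hb : 0 ≤ b) (hx : 0 < x) :
    ∫⁻ u in Set.Ioc 0 b, ENNReal.ofReal (x * Real.exp (-(u * x))) =
      ENNReal.ofReal (1 - Real.exp (-(x * b))) := by
  have hc : Continuous fun u : ℝ => x * Real.exp (-(u * x)) := by fun_prop
  rw [← ofReal_integral_eq_lintegral_ofReal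
    (hc.integrableOn_Icc.mono_set Set.Ioc_subset_Icc_self)
    (ae_of_all _ fun u => by positivity), ← intervalIntegral.integral_of_le hb]
  have hd : ∀ u ∈ Set.uIcc 0 b,
      HasDerivAt (fun u : ℝ => -Real.exp (-(u * x))) (x * Real.exp (-(u * x))) u := by
    intro u _
    have h := (((hasDerivAt_id u).mul_const x).neg.exp).neg
    convert! h using 1
    simp [mul_comm]
  rw [intervalIntegral.integral_eq_sub_of_hasDerivAt hd (hc.intervalIntegrable _ _)]
  congr 1
  simp only [zero_mul, neg_zero, Real.exp_zero, mul_comm b x]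
  ring

theorem lintegral_rpow_mul_exp_neg_mul_Ioi {a u : ℝ} (ha : 0 < a) (hu : 0 < u) :
    ∫⁻ x in Set.Ioi (0 : ℝ), ENNReal.ofReal (x ^ (a - 1) * Real.exp (-(u * x))) =
      ENNReal.ofReal ((1 / u) ^ a * Real.Gamma a) := by
  have h := Real.integral_rpow_mul_exp_neg_mul_Ioi ha hu
  have hpos : 0 < (1 / u) ^ a * Real.Gamma a :=
    mul_pos (Real.rpow_pos_of_pos (by positivity) _) (Real.Gamma_pos_of_pos ha)
  rw [← h, ofReal_integral_eq_lintegral_ofReal]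
  -- A non-integrable function has Bochner integral 0, so the positive value itself proves
  -- integrability.
  · refine Integrable.of_integral_ne_zero ?_
    rw [h]
    exact hpos.ne'
  · filter_upwards [ae_restrict_mem measurableSet_Ioi] with x hx
    exact mul_nonneg (Real.rpow_nonneg (le_of_lt hx) _) (Real.exp_pos _).le

/-- The integral `∫ (1 - e^{-xb}) Γ(1-β)⁻¹ β x^{-β-1} dx = b ^ β`. -/
theorem lintegral_one_sub_exp_karlinScaleMeasure {β b : ℝ} (hβ : 0 < β) (hβ' : β < 1)
    (hb : 0 ≤ b) :
    ∫⁻ x, ENNReal.ofReal (1 - Real.exp (-(x * b))) ∂karlinScaleMeasure β =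
      ENNReal.ofReal (b ^ β) := by
  have hΓ : 0 < Real.Gamma (1 - β) := Real.Gamma_pos_of_pos (by linarith)
  rw [karlinScaleMeasure, lintegral_withDensity_eq_lintegral_mul _ (by fun_prop) (by fun_prop)]
  -- Here x^{-β-1}(1 - e^{-xb}) = ∫_0^b x^{-β} e^{-ux} du. After Tonelli the x-integral is Γ(1-β)
  -- u^{β-1}; the normalisation cancels the Gamma factor, and ∫_0^b β u^{β-1} du remains.
  have h1 : ∫⁻ x in Set.Ioi (0 : ℝ), ((fun x : ℝ =>
        ENNReal.ofReal ((Real.Gamma (1 - β))⁻¹ * β * x ^ (-β - 1))) *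
        fun x => ENNReal.ofReal (1 - Real.exp (-(x * b)))) x =
      ∫⁻ x in Set.Ioi (0 : ℝ), ∫⁻ u in Set.Ioc 0 b,
        ENNReal.ofReal ((Real.Gamma (1 - β))⁻¹ * β) *
          ENNReal.ofReal (x ^ (1 - β - 1) * Real.exp (-(u * x))) := by
    refine setLIntegral_congr_fun measurableSet_Ioi fun x hx => ?_
    have hx' : (0 : ℝ) < x := hx
    simp only [Pi.mul_apply]
    rw [← lintegral_mul_exp_neg_mul_Ioc hb hx, ← lintegral_const_mul _ (by fun_prop)]
    refine lintegral_congr fun u => ?_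
    rw [← ENNReal.ofReal_mul (by positivity), ← ENNReal.ofReal_mul (by positivity)]
    congr 1
    have : x ^ (1 - β - 1) = x ^ (-β - 1) * x := by
      rw [← Real.rpow_add_one hx'.ne']; congr 1; ring
    rw [this]; ring
  have h2 : ∀ u ∈ Set.Ioc 0 b, ∫⁻ x in Set.Ioi (0 : ℝ),
        ENNReal.ofReal ((Real.Gamma (1 - β))⁻¹ * β) *
          ENNReal.ofReal (x ^ (1 - β - 1) * Real.exp (-(u * x))) =
        ENNReal.ofReal (β * u ^ (β - 1)) := by
    intro u hu
    rw [lintegral_const_mul _ (by fun_prop),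
      lintegral_rpow_mul_exp_neg_mul_Ioi (by linarith : 0 < 1 - β) hu.1,
      ← ENNReal.ofReal_mul (by positivity)]
    congr 1
    rw [one_div, Real.inv_rpow hu.1.le, ← Real.rpow_neg hu.1.le, neg_sub]
    field_simp
  rw [h1, lintegral_lintegral_swap (by fun_prop), setLIntegral_congr_fun measurableSet_Ioc h2]
  have hi : IntegrableOn (fun u : ℝ => β * u ^ (β - 1)) (Set.Ioc 0 b) :=
    (((intervalIntegral.intervalIntegrable_rpow' (a := 0) (b := b)
      (by linarith : -1 < β - 1)).const_mul β).1)
  rw [← ofReal_integral_eq_lintegral_ofReal hi, ← intervalIntegral.integral_of_le hb,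
    intervalIntegral.integral_const_mul, integral_rpow (Or.inl (by linarith))]
  · congr 1
    simp only [sub_add_cancel, Real.zero_rpow hβ.ne', sub_zero]
    field_simp
  · filter_upwards [ae_restrict_mem measurableSet_Ioc] with u hu
    exact mul_nonneg hβ.le (Real.rpow_nonneg hu.1.le _)

/-- The event that a scaled point measure charges a given open set is measurable. -/
theorem measurableSet_scaled_ne_zero (G : Opens ℝ) :
    MeasurableSet {x : ℝ × RadonPointMeasure ℝ |
      x ∈ Set.Ioi (0 : ℝ) ×ˢ (Set.univ : Set (RadonPointMeasure ℝ)) ∧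
        x.2.1 ((fun y => x.1 * y) '' (G : Set ℝ)) ≠ 0} := by
  -- The set xG moves with x, so N(xG) is not a fixed evaluation of N. Rational intervals (p, q)
  -- inside x(a, b), with (a, b) ⊆ G rational, cover xG; if N charges xG, it charges one of these
  -- countably many intervals.
  have h : {x : ℝ × RadonPointMeasure ℝ |
      x ∈ Set.Ioi (0 : ℝ) ×ˢ (Set.univ : Set (RadonPointMeasure ℝ)) ∧
        x.2.1 ((fun y => x.1 * y) '' (G : Set ℝ)) ≠ 0} =
      ⋃ (a : ℚ) (b : ℚ) (_ : Set.Ioo (a : ℝ) b ⊆ G) (p : ℚ) (q : ℚ),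
        {x : ℝ × RadonPointMeasure ℝ | 0 < x.1 ∧ x.1 * (a : ℝ) < (p : ℝ) ∧ (q : ℝ) < x.1 * (b : ℝ) ∧ x.2.1 (Set.Ioo (p : ℝ) q) ≠ 0} := by
    ext ⟨x, N⟩
    simp only [Set.mem_prod, Set.mem_Ioi, Set.mem_univ, and_true, Set.mem_ofPred_eq,
      Set.mem_iUnion, exists_prop]
    constructor
    · rintro ⟨hx, hN⟩
      by_contra! hc
      apply hN
      have hsub : (fun y => x * y) '' (G : Set ℝ) ⊆ ⋃ (a : ℚ) (b : ℚ)
          (_ : Set.Ioo (a : ℝ) b ⊆ G) (p : ℚ) (q : ℚ) (_ : x * (a : ℝ) < p) (_ : (q : ℝ) < x * b),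
          Set.Ioo (p : ℝ) q := by
        rintro _ ⟨y, hy, rfl⟩
        obtain ⟨v, hv, hyab, hab⟩ :=
          Real.isTopologicalBasis_Ioo_rat.exists_subset_of_mem_open hy G.isOpen
        simp only [Set.mem_iUnion, Set.mem_singleton_iff] at hv
        obtain ⟨a, b, -, rfl⟩ := hv
        obtain ⟨p, hp1, hp2⟩ := exists_rat_btwn (mul_lt_mul_of_pos_left hyab.1 hx)
        obtain ⟨q, hq1, hq2⟩ := exists_rat_btwn (mul_lt_mul_of_pos_left hyab.2 hx)
        simp only [Set.mem_iUnion]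
        exact ⟨a, b, hab, p, q, hp1, hq2, hp2, hq1⟩
      refine measure_mono_null hsub ?_
      simp only [measure_iUnion_null_iff]
      exact fun a b hab p q h1 h2 => hc a b hab p q hx h1 h2
    · rintro ⟨a, b, hab, p, q, hx, h1, h2, hN⟩
      refine ⟨hx, fun h0 => hN (measure_mono_null ?_ h0)⟩
      intro y hy
      refine ⟨x⁻¹ * y, hab ⟨?_, ?_⟩, by field_simp⟩
      · rw [lt_inv_mul_iff₀ hx]; exact h1.trans hy.1
      · rw [inv_mul_lt_iff₀ hx]; exact hy.2.trans h2
  rw [h]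
  refine MeasurableSet.iUnion fun a => MeasurableSet.iUnion fun b => MeasurableSet.iUnion fun _ =>
    MeasurableSet.iUnion fun p => MeasurableSet.iUnion fun q => ?_
  have hN : Measurable fun x : ℝ × RadonPointMeasure ℝ => x.2.1 (Set.Ioo (p : ℝ) q) :=
    (Measure.measurable_coe measurableSet_Ioo).comp (measurable_subtype_coe.comp measurable_snd)
  refine (measurableSet_lt measurable_const measurable_fst).inter
    ((measurableSet_lt (measurable_fst.mul_const _) measurable_const).inter
    ((measurableSet_lt measurable_const (measurable_fst.mul_const _)).inter ?_))
  exact (hN (measurableSet_singleton 0)).compl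

instance (β : ℝ) : SFinite (karlinScaleMeasure β) := by
  unfold karlinScaleMeasure; infer_instance

theorem karlinScaleMeasure_prod_compl (β : ℝ) (Pt : Measure (RadonPointMeasure ℝ))
    [IsProbabilityMeasure Pt] :
    ((karlinScaleMeasure β).prod Pt)
      (Set.Ioi (0 : ℝ) ×ˢ (Set.univ : Set (RadonPointMeasure ℝ)))ᶜ = 0 := by
  have h : (Set.Ioi (0 : ℝ) ×ˢ (Set.univ : Set (RadonPointMeasure ℝ)))ᶜ =
      (Set.Ioi (0 : ℝ))ᶜ ×ˢ Set.univ := by ext; simp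
  rw [h, Measure.prod_prod, karlinScaleMeasure, withDensity_apply _ measurableSet_Ioi.compl,
    Measure.restrict_restrict measurableSet_Ioi.compl,
    Set.compl_inter_self, Measure.restrict_empty, lintegral_zero_measure, zero_mul]

open scoped Pointwise in
/-- The mass of the scaled point measures that charge a given open set. -/
theorem karlinScaleMeasure_prod_scaled_ne_zero {Pt : Measure (RadonPointMeasure ℝ)}
    [IsProbabilityMeasure Pt]
    (hPt : IsPoissonRandomMeasure Pt (volume : Measure ℝ) Subtype.val) {β : ℝ} (hβ : 0 < β)
    (hβ' : β < 1) {G : Opens ℝ} (hG : volume (G : Set ℝ) ≠ ∞) :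
    ((karlinScaleMeasure β).prod Pt) {x |
      x ∈ Set.Ioi (0 : ℝ) ×ˢ (Set.univ : Set (RadonPointMeasure ℝ)) ∧
        x.2.1 ((fun y => x.1 * y) '' (G : Set ℝ)) ≠ 0} =
      ENNReal.ofReal ((volume (G : Set ℝ)).toReal ^ β) := by
  rw [Measure.prod_apply (measurableSet_scaled_ne_zero G),
    ← lintegral_one_sub_exp_karlinScaleMeasure hβ hβ' ENNReal.toReal_nonneg]
  have hpos : ∀ᵐ x ∂karlinScaleMeasure β, x ∈ Set.Ioi (0 : ℝ) :=
    (withDensity_absolutelyContinuous _ _).ae_le (ae_restrict_mem measurableSet_Ioi)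
  refine lintegral_congr_ae ?_
  filter_upwards [hpos] with x hx
  have hx' : (0 : ℝ) < x := hx
  have hm : MeasurableSet ((fun y => x * y) '' (G : Set ℝ)) :=
    ((Homeomorph.mulLeft₀ x hx'.ne').isOpenMap _ G.isOpen).measurableSet
  have hv : volume ((fun y => x * y) '' (G : Set ℝ)) = ENNReal.ofReal x * volume (G : Set ℝ) := by
    have h := Measure.addHaar_smul (volume : Measure ℝ) x (G : Set ℝ)
    rw [Module.finrank_self, pow_one, abs_of_pos hx'] at h
    exact h
  have hvt : volume ((fun y => x * y) '' (G : Set ℝ)) ≠ ∞ := by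
    rw [hv]; exact ENNReal.mul_ne_top ENNReal.ofReal_ne_top hG
  -- For fixed x the Poisson measure misses xG with probability e^{-x|G|}, which leaves the integral
  -- of 1 - e^{-x|G|} against the scale measure.
  have h0 := hPt.measure_eq_zero hm hvt
  have hms : MeasurableSet {N : RadonPointMeasure ℝ |
      N.1 ((fun y => x * y) '' (G : Set ℝ)) = 0} :=
    ((Measure.measurable_coe hm).comp measurable_subtype_coe) (measurableSet_singleton 0)
  have hset : (Prod.mk x ⁻¹' {x : ℝ × RadonPointMeasure ℝ |
      x ∈ Set.Ioi (0 : ℝ) ×ˢ (Set.univ : Set (RadonPointMeasure ℝ)) ∧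
        x.2.1 ((fun y => x.1 * y) '' (G : Set ℝ)) ≠ 0}) =
      {N : RadonPointMeasure ℝ | N.1 ((fun y => x * y) '' (G : Set ℝ)) = 0}ᶜ := by
    ext N; simp [hx']
  rw [hset, prob_compl_eq_one_sub hms, h0, hv, ENNReal.ofReal_sub _ (Real.exp_pos _).le,
    ENNReal.ofReal_one, ENNReal.toReal_mul, ENNReal.toReal_ofReal hx'.le]

namespace SupMeasure

/-! ### Random sup-measures with Karlin-type joint distribution functions -/

/-- The exponent of the joint distribution function of the Karlin random sup-measure. -/
noncomputable def karlinExponent (α : ℝ) (s : Finset (Opens ℝ × ℝ≥0∞)) (b : ℝ) : ℝ≥0∞ :=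
  ∫⁻ γ in Set.Ioi (0 : ℝ), ENNReal.ofReal ((volume (activeUnion α s γ : Set ℝ)).toReal ^ b)

/-- The joint distribution functions of `M` at open sets of finite length are given by
`karlinExponent`. -/
structure IsKarlinLaw {Ω : Type*} [MeasurableSpace Ω] (P : Measure Ω) (M : Ω → SupMeasure ℝ)
    (α b : ℝ) : Prop where
  nullMeasurableSet : ∀ s : Finset (Opens ℝ × ℝ≥0∞),
    NullMeasurableSet {ω | ∀ p ∈ s, M ω p.1 ≤ p.2} P
  cdf : ∀ s : Finset (Opens ℝ × ℝ≥0∞),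
    (∀ p ∈ s, volume (p.1 : Set ℝ) ≠ ∞ ∧ p.2 ≠ 0 ∧ p.2 ≠ ∞) →
    P {ω | ∀ p ∈ s, M ω p.1 ≤ p.2} = ENNReal.ofReal (Real.exp (-(karlinExponent α s b).toReal))

theorem volume_activeUnion_le (α : ℝ) (s : Finset (Opens ℝ × ℝ≥0∞)) (γ : ℝ) :
    volume (activeUnion α s γ : Set ℝ) ≤ ∑ p ∈ s, volume (p.1 : Set ℝ) := by
  rw [coe_activeUnion]
  refine le_trans (measure_mono ?_)
    (measure_biUnion_finset_le s fun p : Opens ℝ × ℝ≥0∞ => (p.1 : Set ℝ))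
  exact Set.iUnion₂_mono fun p _ => Set.iUnion_subset fun _ => Set.Subset.rfl

theorem sum_volume_ne_top {s : Finset (Opens ℝ × ℝ≥0∞)}
    (hs : ∀ p ∈ s, volume (p.1 : Set ℝ) ≠ ∞ ∧ p.2 ≠ 0 ∧ p.2 ≠ ∞) :
    ∑ p ∈ s, volume (p.1 : Set ℝ) ≠ ∞ :=
  (ENNReal.sum_lt_top.2 fun p hp => (hs p hp).1.lt_top).ne

theorem volume_activeUnion_ne_top {s : Finset (Opens ℝ × ℝ≥0∞)}
    (hs : ∀ p ∈ s, volume (p.1 : Set ℝ) ≠ ∞ ∧ p.2 ≠ 0 ∧ p.2 ≠ ∞) (α γ : ℝ) :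
    volume (activeUnion α s γ : Set ℝ) ≠ ∞ :=
  ne_top_of_le_ne_top (sum_volume_ne_top hs) (volume_activeUnion_le α s γ)

theorem isKarlinLaw_karlinSupMeasure {α : ℝ} (hα : 0 < α) {Pt : Measure (RadonPointMeasure ℝ)}
    [IsProbabilityMeasure Pt]
    (hPt : IsPoissonRandomMeasure Pt (volume : Measure ℝ) Subtype.val)
    {β : ℝ} (hβ : 0 < β) (hβ' : β < 1) {Ω : Type*} [MeasurableSpace Ω] {P : Measure Ω}
    [IsProbabilityMeasure P] {X : ℕ → Ω → ℝ × ℝ × RadonPointMeasure ℝ}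
    (hX : IsPoissonEnumeration P (karlinIntensity β Pt) X) :
    IsKarlinLaw P (fun ω => karlinSupMeasure α (fun l => X l ω)) α β := by
  have hS₀ : MeasurableSet (Set.Ioi (0 : ℝ) ×ˢ (Set.univ : Set (RadonPointMeasure ℝ))) :=
    measurableSet_Ioi.prod MeasurableSet.univ
  have hν := karlinScaleMeasure_prod_compl β Pt
  refine ⟨fun s => nullMeasurableSet_ofHits_le (α := α) hX
    (fun x => measure_scaled_sSup_ne_zero_iff x.2.1 x.1) hS₀ hν measurableSet_scaled_ne_zero s,
    fun s hs => ?_⟩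
  refine (measure_ofHits_le hX hα (fun x => measure_scaled_sSup_ne_zero_iff x.2.1 x.1) hS₀ hν
    measurableSet_scaled_ne_zero (fun p hp => (hs p hp).2) fun p hp => ?_).trans ?_
  · rw [karlinScaleMeasure_prod_scaled_ne_zero hPt hβ hβ' (hs p hp).1]
    exact ENNReal.ofReal_ne_top
  · simp only [karlinExponent, karlinScaleMeasure_prod_scaled_ne_zero hPt hβ hβ'
      (volume_activeUnion_ne_top hs α _)]

/-- Here the points hitting G have mass |G| = |G|^1. This puts the limit β ↑ 1 into the same family,
where it becomes continuity in the exponent. -/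
theorem isKarlinLaw_scattered {α : ℝ} (hα : 0 < α) {Ω : Type*} [MeasurableSpace Ω]
    {P : Measure Ω} [IsProbabilityMeasure P] {Y : ℕ → Ω → ℝ × ℝ}
    (hY : IsPoissonEnumeration P
      ((volume.restrict (Set.Ioi (0 : ℝ))).prod (volume : Measure ℝ)) Y) :
    IsKarlinLaw P (fun ω => scattered α (fun l => Y l ω)) α 1 := by
  have hm : ∀ G : Opens ℝ, MeasurableSet {x : ℝ | x ∈ (Set.univ : Set ℝ) ∧ x ∈ G} := by
    intro G
    simpa using G.isOpen.measurableSet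
  have hG : ∀ G : Opens ℝ, {x : ℝ | x ∈ (Set.univ : Set ℝ) ∧ x ∈ G} = G := by
    intro G; ext; simp
  refine ⟨fun s => nullMeasurableSet_ofHits_le (α := α) (hit := fun (x : ℝ) (G : Opens ℝ) => x ∈ G)
    hY (fun _ _ => Opens.mem_sSup) MeasurableSet.univ (by simp) hm s, fun s hs => ?_⟩
  refine (measure_ofHits_le (hit := fun (x : ℝ) (G : Opens ℝ) => x ∈ G) hY hα
    (fun _ _ => Opens.mem_sSup) MeasurableSet.univ (by simp) hm
    (fun p hp => (hs p hp).2) fun p hp => ?_).trans ?_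
  · rw [hG]; exact (hs p hp).1
  · simp only [karlinExponent, Real.rpow_one, hG,
      ENNReal.ofReal_toReal (volume_activeUnion_ne_top hs α _)]

/-! ### Convergence of the exponents -/

theorem measurable_volume_activeUnion (α : ℝ) (s : Finset (Opens ℝ × ℝ≥0∞)) :
    Measurable fun γ => volume (activeUnion α s γ : Set ℝ) := by
  have h : MeasurableSet {x : ℝ × ℝ | x.2 ∈ (activeUnion α s x.1 : Set ℝ)} := by
    have h1 : {x : ℝ × ℝ | x.2 ∈ (activeUnion α s x.1 : Set ℝ)} =
        ⋃ p ∈ s, {γ : ℝ | p.2 < ENNReal.ofReal (1 / γ ^ (1 / α))} ×ˢ (p.1 : Set ℝ) := by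
      ext x
      rw [Set.mem_ofPred_eq, coe_activeUnion]
      simp only [Set.mem_iUnion, Set.mem_prod, Set.mem_ofPred_eq, exists_prop]
    rw [h1]
    refine s.measurableSet_biUnion fun p _ => MeasurableSet.prod ?_ p.1.isOpen.measurableSet
    exact measurableSet_lt measurable_const (by fun_prop)
  exact measurable_measure_prodMk_left h

/-- One majorant serves all exponents in (0, 1]. Beyond c, which dominates every cutoff z^{-α}, no
set is active and 0^b = 0. Below c, the base is enlarged to 1 + C ≥ 1, whose powers increase with
the exponent and so are at most 1 + C. -/
theorem exists_bound_rpow_volume_activeUnion {α : ℝ} (hα : 0 < α)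
    {s : Finset (Opens ℝ × ℝ≥0∞)}
    (hs : ∀ p ∈ s, volume (p.1 : Set ℝ) ≠ ∞ ∧ p.2 ≠ 0 ∧ p.2 ≠ ∞) :
    ∃ g : ℝ → ℝ≥0∞, ∫⁻ γ in Set.Ioi (0 : ℝ), g γ ≠ ∞ ∧
      ∀ γ, 0 < γ → ∀ b : ℝ, 0 < b → b ≤ 1 →
        ENNReal.ofReal ((volume (activeUnion α s γ : Set ℝ)).toReal ^ b) ≤ g γ := by
  set C : ℝ := (∑ p ∈ s, volume (p.1 : Set ℝ)).toReal with hC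
  set c : ℝ := ∑ p ∈ s, p.2.toReal ^ (-α) with hc
  refine ⟨(Set.Ioo 0 c).indicator fun _ => ENNReal.ofReal (1 + C), ?_, ?_⟩
  · refine ne_top_of_le_ne_top ?_ (setLIntegral_le_lintegral _ _)
    rw [lintegral_indicator measurableSet_Ioo, setLIntegral_const]
    exact ENNReal.mul_ne_top ENNReal.ofReal_ne_top measure_Ioo_lt_top.ne
  · intro γ hγ b hb hb'
    by_cases hγc : γ < c
    · rw [Set.indicator_of_mem (Set.mem_Ioo.2 ⟨hγ, hγc⟩)]
      refine ENNReal.ofReal_le_ofReal ?_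
      have h1 : (volume (activeUnion α s γ : Set ℝ)).toReal ≤ 1 + C :=
        (ENNReal.toReal_mono (sum_volume_ne_top hs) (volume_activeUnion_le α s γ)).trans
          (by linarith)
      calc _ ≤ (1 + C) ^ b := Real.rpow_le_rpow ENNReal.toReal_nonneg h1 hb.le
        _ ≤ (1 + C) ^ (1 : ℝ) := Real.rpow_le_rpow_of_exponent_le
            (by linarith [hC ▸ ENNReal.toReal_nonneg]) hb'
        _ = _ := Real.rpow_one _
    · have h1 : (activeUnion α s γ : Set ℝ) = ∅ := by
        rw [coe_activeUnion]
        simp only [Set.iUnion_eq_empty]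
        intro p hp h
        refine absurd ?_ hγc
        refine ((lt_ofReal_one_div_rpow_iff hα hγ (hs p hp).2.1 (hs p hp).2.2).1 h).trans_le ?_
        exact Finset.single_le_sum (f := fun p : Opens ℝ × ℝ≥0∞ => p.2.toReal ^ (-α))
          (fun q _ => Real.rpow_nonneg ENNReal.toReal_nonneg _) hp
      simp [h1, Real.zero_rpow hb.ne']

/-- Dominated convergence for the joint distribution functions. -/
theorem tendsto_cdf_of_tendsto_rpow {α : ℝ} (hα : 0 < α) {ι : Type*} {l : Filter ι}
    [l.IsCountablyGenerated] {b : ι → ℝ} (hb : ∀ i, 0 < b i ∧ b i ≤ 1)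
    {s : Finset (Opens ℝ × ℝ≥0∞)}
    (hs : ∀ p ∈ s, volume (p.1 : Set ℝ) ≠ ∞ ∧ p.2 ≠ 0 ∧ p.2 ≠ ∞) {f : ℝ → ℝ≥0∞}
    (hf : ∀ γ, 0 < γ → Tendsto (fun i =>
      ENNReal.ofReal ((volume (activeUnion α s γ : Set ℝ)).toReal ^ b i)) l (𝓝 (f γ))) :
    Tendsto (fun i => ENNReal.ofReal (Real.exp (-(karlinExponent α s (b i)).toReal))) l
      (𝓝 (ENNReal.ofReal (Real.exp (-(∫⁻ γ in Set.Ioi (0 : ℝ), f γ).toReal)))) := by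
  rcases l.eq_or_neBot with rfl | hl
  · exact tendsto_bot
  obtain ⟨g, hg, hbound⟩ := exists_bound_rpow_volume_activeUnion hα hs
  have h1 : Tendsto (fun i => karlinExponent α s (b i)) l
      (𝓝 (∫⁻ γ in Set.Ioi (0 : ℝ), f γ)) := by
    refine tendsto_lintegral_filter_of_dominated_convergence g ?_ ?_ hg ?_
    · exact Eventually.of_forall fun i =>
        ((measurable_volume_activeUnion α s).ennreal_toReal.pow_const _).ennreal_ofReal
    · refine Eventually.of_forall fun i => ?_
      filter_upwards [ae_restrict_mem measurableSet_Ioi] with γ hγ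
      exact hbound γ hγ _ (hb i).1 (hb i).2
    · filter_upwards [ae_restrict_mem measurableSet_Ioi] with γ hγ
      exact hf γ hγ
  -- `ENNReal.toReal` is continuous only at finite values, so the limiting exponent has to be
  -- finite.
  have h2 : ∫⁻ γ in Set.Ioi (0 : ℝ), f γ ≠ ∞ := by
    refine ne_top_of_le_ne_top hg (setLIntegral_mono' measurableSet_Ioi fun γ hγ => ?_)
    exact le_of_tendsto (hf γ hγ) (Eventually.of_forall fun i => hbound γ hγ _ (hb i).1 (hb i).2)
  exact ENNReal.tendsto_ofReal ((Real.continuous_exp.tendsto _).comp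
    ((ENNReal.tendsto_toReal h2).comp h1).neg)

theorem tendsto_ofReal_rpow_nhds_one {ι : Type*} {l : Filter ι} {b : ι → ℝ}
    (hb : Tendsto b l (𝓝 1)) (r : ℝ) :
    Tendsto (fun i => ENNReal.ofReal (r ^ b i)) l (𝓝 (ENNReal.ofReal (r ^ (1 : ℝ)))) :=
  ENNReal.tendsto_ofReal ((Real.continuousAt_const_rpow' one_ne_zero).tendsto.comp hb)

-- A nonempty open set has positive length v, and v^b → v^0 = 1. For the empty set 0^b = 0 as long
-- as b > 0, whereas 0^0 = 1; hence the positivity of every b i.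
open Classical in
theorem tendsto_ofReal_rpow_nhds_zero {ι : Type*} {l : Filter ι} {b : ι → ℝ}
    (hb : Tendsto b l (𝓝 0)) (hb0 : ∀ i, 0 < b i) {G : Opens ℝ} (hG : volume (G : Set ℝ) ≠ ∞) :
    Tendsto (fun i => ENNReal.ofReal ((volume (G : Set ℝ)).toReal ^ b i)) l
      (𝓝 (if (G : Set ℝ).Nonempty then 1 else 0)) := by
  split_ifs with h
  · have h1 : (volume (G : Set ℝ)).toReal ≠ 0 :=
      ENNReal.toReal_ne_zero.2 ⟨(G.isOpen.measure_pos volume h).ne', hG⟩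
    have h2 := ENNReal.tendsto_ofReal ((Real.continuousAt_const_rpow h1).tendsto.comp hb)
    simpa using h2
  · rw [Set.not_nonempty_iff_eq_empty] at h
    simpa [h, Real.zero_rpow (hb0 _).ne'] using tendsto_const_nhds

/-! ### The completely dependent sup-measure -/

section CompletelyDependent

variable {E : Type*} [TopologicalSpace E]

theorem nonempty_activeUnion_iff {α : ℝ} {s : Finset (Opens E × ℝ≥0∞)} {γ : ℝ} :
    (activeUnion α s γ : Set E).Nonempty ↔
      ∃ p ∈ s, p.2 < ENNReal.ofReal (1 / γ ^ (1 / α)) ∧ (p.1 : Set E).Nonempty := by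
  rw [coe_activeUnion]
  simp only [Set.nonempty_iUnion, exists_prop]

theorem completelyDependent_apply_le_iff {z : ℝ≥0∞} {G : Opens E} {c : ℝ≥0∞} :
    completelyDependent E z G ≤ c ↔ ((G : Set E).Nonempty → z ≤ c) := by
  rw [completelyDependent, ofHits_apply_le_iff]
  exact ⟨fun h => h 0, fun h _ => h⟩

variable {α : ℝ} {Ω : Type*} [MeasurableSpace Ω] {P : Measure Ω} {Z : Ω → ℝ}

theorem measurableSet_completelyDependent_le (hZ : Measurable Z) (G : Opens E) (c : ℝ≥0∞) :
    MeasurableSet {ω | completelyDependent E (ENNReal.ofReal (Z ω)) G ≤ c} := by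
  simp only [completelyDependent_apply_le_iff]
  by_cases h : (G : Set E).Nonempty
  · simpa [h] using measurableSet_le hZ.ennreal_ofReal measurable_const
  · simp [h]

-- Only nonempty sets constrain Z, and the smallest level among them decides. The Fréchet exponent
-- z^{-α} is the length of the set of γ for which some nonempty set is active, which gives the form
-- needed for the limit β ↓ 0.
open Classical in
theorem measure_completelyDependent_le (hα : 0 < α) [IsProbabilityMeasure P]
    (hZ : IsStandardFrechet P α Z) {s : Finset (Opens E × ℝ≥0∞)}
    (hs : ∀ p ∈ s, p.2 ≠ 0 ∧ p.2 ≠ ∞) :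
    P {ω | ∀ p ∈ s, completelyDependent E (ENNReal.ofReal (Z ω)) p.1 ≤ p.2} =
      ENNReal.ofReal (Real.exp (-(∫⁻ γ in Set.Ioi (0 : ℝ),
        if (activeUnion α s γ : Set E).Nonempty then 1 else 0).toReal)) := by
  simp only [completelyDependent_apply_le_iff, nonempty_activeUnion_iff]
  set T := s.filter fun p => (p.1 : Set E).Nonempty with hT
  rcases T.eq_empty_or_nonempty with h | h
  · have h1 : ∀ p ∈ s, ¬ (p.1 : Set E).Nonempty := Finset.filter_eq_empty_iff.1 h
    have h2 : {ω | ∀ p ∈ s, (p.1 : Set E).Nonempty → ENNReal.ofReal (Z ω) ≤ p.2} = Set.univ :=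
      Set.eq_univ_of_forall fun ω p hp hne => absurd hne (h1 p hp)
    have h3 : ∀ γ : ℝ, ¬ ∃ p ∈ s, p.2 < ENNReal.ofReal (1 / γ ^ (1 / α)) ∧
        (p.1 : Set E).Nonempty := by
      rintro γ ⟨p, hp, -, hne⟩
      exact h1 p hp hne
    simp only [h2, h3, if_false, measure_univ]
    simp
  · obtain ⟨q, hq, hmin⟩ := T.exists_min_image (fun p => p.2) h
    obtain ⟨hqs, hqne⟩ := Finset.mem_filter.1 hq
    obtain ⟨hq0, hqt⟩ := hs q hqs
    have hpos : 0 < q.2.toReal := ENNReal.toReal_pos hq0 hqt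
    have h2 : {ω | ∀ p ∈ s, (p.1 : Set E).Nonempty → ENNReal.ofReal (Z ω) ≤ p.2} =
        {ω | Z ω ≤ q.2.toReal} := by
      ext ω
      simp only [Set.mem_ofPred_eq, ← ENNReal.ofReal_le_iff_le_toReal hqt]
      exact ⟨fun h => h q hqs hqne,
        fun h p hp hne => h.trans (hmin p (Finset.mem_filter.2 ⟨hp, hne⟩))⟩
    have h3 : ∀ γ : ℝ, (∃ p ∈ s, p.2 < ENNReal.ofReal (1 / γ ^ (1 / α)) ∧
        (p.1 : Set E).Nonempty) ↔ q.2 < ENNReal.ofReal (1 / γ ^ (1 / α)) := by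
      intro γ
      exact ⟨fun ⟨p, hp, h, hne⟩ => (hmin p (Finset.mem_filter.2 ⟨hp, hne⟩)).trans_lt h,
        fun h => ⟨q, hqs, h, hqne⟩⟩
    have hpos' : 0 ≤ q.2.toReal ^ (-α) := Real.rpow_nonneg hpos.le _
    have h4 : ∫⁻ γ in Set.Ioi (0 : ℝ),
        (if q.2 < ENNReal.ofReal (1 / γ ^ (1 / α)) then 1 else 0) =
        ENNReal.ofReal (q.2.toReal ^ (-α)) := by
      have hm : MeasurableSet {γ : ℝ | q.2 < ENNReal.ofReal (1 / γ ^ (1 / α))} :=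
        measurableSet_lt measurable_const (by fun_prop)
      have h5 := lintegral_indicator_one (μ := volume.restrict (Set.Ioi (0 : ℝ))) hm
      rw [Measure.restrict_apply hm, Set.inter_comm, setOf_lt_weight_eq hα hq0 hqt,
        Real.volume_Ioo, sub_zero] at h5
      rw [← h5]
      refine lintegral_congr fun γ => ?_
      simp [Set.indicator_apply]
    rw [h2, hZ.cdf _ hpos]
    simp only [h3, h4, ENNReal.toReal_ofReal hpos']

end CompletelyDependent

/-! ### Restriction to the unit interval -/

/-- The part of a relatively open subset of `[0, 1]` in `(0, 1)`, as an open subset of `ℝ`. -/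
def interiorPart (U : Opens (Set.Icc (0 : ℝ) 1)) : Opens ℝ :=
  ⟨Subtype.val '' (U : Set (Set.Icc (0 : ℝ) 1)) ∩ Set.Ioo 0 1, by
    obtain ⟨V, hV, hVU⟩ := isOpen_induced_iff.1 U.isOpen
    rw [← hVU, Subtype.image_preimage_coe, Set.inter_comm, ← Set.inter_assoc,
      Set.inter_eq_left.2 Set.Ioo_subset_Icc_self]
    exact isOpen_Ioo.inter hV⟩

theorem volume_interiorPart_ne_top (U : Opens (Set.Icc (0 : ℝ) 1)) :
    volume (interiorPart U : Set ℝ) ≠ ∞ :=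
  ((measure_mono Set.inter_subset_right).trans_lt measure_Ioo_lt_top).ne

/-- Density of (0,1) in [0,1]: dropping the endpoints is invisible to the completely dependent
limit. -/
theorem nonempty_interiorPart_iff {U : Opens (Set.Icc (0 : ℝ) 1)} :
    (interiorPart U : Set ℝ).Nonempty ↔ (U : Set (Set.Icc (0 : ℝ) 1)).Nonempty := by
  constructor
  · rintro ⟨_, ⟨x, hx, rfl⟩, -⟩
    exact ⟨x, hx⟩
  · rintro ⟨x, hx⟩
    obtain ⟨V, hV, hVU⟩ := isOpen_induced_iff.1 U.isOpen
    have hx' : (x : ℝ) ∈ closure (Set.Ioo (0 : ℝ) 1) := by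
      rw [closure_Ioo zero_ne_one]; exact x.2
    obtain ⟨y, hyV, hy⟩ := mem_closure_iff.1 hx' V hV (by rw [← hVU] at hx; exact hx)
    refine ⟨y, ⟨⟨y, Set.Ioo_subset_Icc_self hy⟩, ?_, rfl⟩, hy⟩
    rw [← hVU]; exact hyV

/-- The extension turns arbitrary unions into suprema, so endpoints that carry no mass contribute
nothing to the value. -/
theorem restrict_Icc_apply {m : SupMeasure ℝ} (h0 : m.extend {0} = 0) (h1 : m.extend {1} = 0)
    (U : Opens (Set.Icc (0 : ℝ) 1)) :
    m.restrict (Set.Icc (0 : ℝ) 1) U = m (interiorPart U) := by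
  change m.extend _ = _
  apply le_antisymm
  · have hsub : Subtype.val '' (U : Set (Set.Icc (0 : ℝ) 1)) ⊆
        ⋃₀ {(interiorPart U : Set ℝ), {0}, {1}} := by
      intro x hx
      obtain ⟨y, hy, rfl⟩ := hx
      simp only [Set.sUnion_insert, Set.sUnion_singleton, Set.mem_union, Set.mem_singleton_iff]
      by_cases hy0 : (y : ℝ) = 0
      · exact Or.inr (Or.inl hy0)
      by_cases hy1 : (y : ℝ) = 1
      · exact Or.inr (Or.inr hy1)
      · exact Or.inl ⟨⟨y, hy, rfl⟩, lt_of_le_of_ne y.2.1 (Ne.symm hy0), lt_of_le_of_ne y.2.2 hy1⟩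
    refine (extend_mono m hsub).trans ?_
    rw [extend_sUnion]
    simp [h0, h1, extend_coe]
  · rw [← extend_coe]
    exact extend_mono m Set.inter_subset_left

/-! ### Absence of fixed atoms and the law of the restriction. -/

namespace IsKarlinLaw

variable {α b : ℝ} {Ω : Type*} [MeasurableSpace Ω] {P : Measure Ω} {M : Ω → SupMeasure ℝ}

theorem nullMeasurableSet_apply_le (hM : IsKarlinLaw P M α b) (G : Opens ℝ) (z : ℝ≥0∞) :
    NullMeasurableSet {ω | M ω G ≤ z} P := by
  simpa using hM.nullMeasurableSet {(G, z)}

theorem aemeasurable (hM : IsKarlinLaw P M α b) : AEMeasurable M P :=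
  aemeasurable_of_nullMeasurableSet fun G _ z _ _ => hM.nullMeasurableSet_apply_le G z

variable [IsProbabilityMeasure P]

/-- The tail is 1 - e^{-x} ≤ x, with x the exponent for the single pair (G, z). It vanishes as G
shrinks, which excludes fixed atoms. -/
theorem measure_lt_apply_le (hM : IsKarlinLaw P M α b) (hα : 0 < α) (hb : 0 < b) {G : Opens ℝ}
    (hG : volume (G : Set ℝ) ≠ ∞) {z : ℝ≥0∞} (hz : z ≠ 0) (hz' : z ≠ ∞) :
    P {ω | z < M ω G} ≤
      ENNReal.ofReal ((volume (G : Set ℝ)).toReal ^ b * z.toReal ^ (-α)) := by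
  have h1 : karlinExponent α {(G, z)} b ≤
      ENNReal.ofReal ((volume (G : Set ℝ)).toReal ^ b * z.toReal ^ (-α)) := by
    have h2 : ∀ γ ∈ Set.Ioi (0 : ℝ),
        ENNReal.ofReal ((volume (activeUnion α {(G, z)} γ : Set ℝ)).toReal ^ b) ≤
        (Set.Ioo 0 (z.toReal ^ (-α))).indicator
          (fun _ => ENNReal.ofReal ((volume (G : Set ℝ)).toReal ^ b)) γ := by
      intro γ hγ
      rw [coe_activeUnion]
      by_cases h : z < ENNReal.ofReal (1 / γ ^ (1 / α))
      · rw [Set.indicator_of_mem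
          (Set.mem_Ioo.2 ⟨hγ, (lt_ofReal_one_div_rpow_iff hα hγ hz hz').1 h⟩)]
        simp only [Finset.mem_singleton, Set.iUnion_iUnion_eq_left, h, Set.iUnion_true, le_refl]
      · simp only [Finset.mem_singleton, Set.iUnion_iUnion_eq_left, h, Set.iUnion_false,
          measure_empty, ENNReal.toReal_zero, Real.zero_rpow hb.ne',
          ENNReal.ofReal_zero, zero_le]
    refine (setLIntegral_mono' measurableSet_Ioi h2).trans ?_
    refine (setLIntegral_le_lintegral _ _).trans ?_
    rw [lintegral_indicator measurableSet_Ioo, setLIntegral_const, Real.volume_Ioo, sub_zero,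
      ← ENNReal.ofReal_mul (Real.rpow_nonneg ENNReal.toReal_nonneg _)]
  have h2 : P {ω | M ω G ≤ z} =
      ENNReal.ofReal (Real.exp (-(karlinExponent α {(G, z)} b).toReal)) := by
    simpa using hM.cdf {(G, z)} (by simpa using ⟨hG, hz, hz'⟩)
  have h3 : {ω | z < M ω G} = {ω | M ω G ≤ z}ᶜ := by ext; simp
  rw [h3, prob_compl_eq_one_sub₀ (hM.nullMeasurableSet_apply_le G z), h2]
  refine le_trans ?_ h1
  rw [← ENNReal.ofReal_toReal (ne_top_of_le_ne_top ENNReal.ofReal_ne_top h1),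
    ← ENNReal.ofReal_one, ← ENNReal.ofReal_sub _ (Real.exp_pos _).le]
  refine ENNReal.ofReal_le_ofReal ?_
  rw [ENNReal.toReal_ofReal ENNReal.toReal_nonneg]
  linarith [Real.add_one_le_exp (-(karlinExponent α {(G, z)} b).toReal)]

/-- There are almost surely no fixed atoms. -/
theorem ae_extend_singleton_eq_zero (hM : IsKarlinLaw P M α b) (hα : 0 < α) (hb : 0 < b)
    (a : ℝ) : ∀ᵐ ω ∂P, (M ω).extend {a} = 0 := by
  have key : ∀ z : ℝ≥0∞, z ≠ 0 → z ≠ ∞ → P {ω | z < (M ω).extend {a}} = 0 := by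
    intro z hz hz'
    have hlim : Tendsto (fun n : ℕ => ENNReal.ofReal
        ((2 * (1 / ((n : ℝ) + 1))) ^ b * z.toReal ^ (-α))) atTop (𝓝 0) := by
      have h1 : Tendsto (fun n : ℕ => 2 * (1 / ((n : ℝ) + 1))) atTop (𝓝 (2 * 0)) :=
        tendsto_one_div_add_atTop_nhds_zero_nat.const_mul 2
      have h2 := ENNReal.tendsto_ofReal
        ((h1.rpow_const (p := b) (Or.inr hb.le)).mul_const (z.toReal ^ (-α)))
      simpa [Real.zero_rpow hb.ne'] using h2
    refine le_antisymm (ge_of_tendsto' hlim fun n => ?_) bot_le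
    have hn : (0 : ℝ) < 1 / ((n : ℝ) + 1) := Nat.one_div_pos_of_nat
    let B : Opens ℝ := ⟨Metric.ball a (1 / ((n : ℝ) + 1)), Metric.isOpen_ball⟩
    have hB : volume (B : Set ℝ) = ENNReal.ofReal (2 * (1 / ((n : ℝ) + 1))) :=
      Real.volume_ball _ _
    have h1 := hM.measure_lt_apply_le hα hb (G := B) (by rw [hB]; exact ENNReal.ofReal_ne_top)
      hz hz'
    rw [hB, ENNReal.toReal_ofReal (by positivity)] at h1
    refine (measure_mono fun ω (hω : z < (M ω).extend {a}) => ?_).trans h1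
    exact hω.trans_le (iInf₂_le B (by simpa [B] using hn))
  -- The tail bound requires a positive finite level, so 0 is approached along countably many such
  -- levels.
  have h : ∀ᵐ ω ∂P, ∀ n : ℕ, (M ω).extend {a} ≤ ((n : ℝ≥0∞) + 1)⁻¹ := by
    rw [ae_all_iff]
    intro n
    rw [ae_iff]
    simpa only [not_le] using key ((n : ℝ≥0∞) + 1)⁻¹ (by simp) (by simp)
  filter_upwards [h] with ω hω
  by_contra hne
  obtain ⟨n, hn⟩ := ENNReal.exists_inv_nat_lt hne
  refine (((hω n).trans (ENNReal.inv_le_inv.2 ?_)).trans_lt hn).false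
  exact le_self_add

theorem ae_restrict_apply (hM : IsKarlinLaw P M α b) (hα : 0 < α) (hb : 0 < b) :
    ∀ᵐ ω ∂P, ∀ U, (M ω).restrict (Set.Icc (0 : ℝ) 1) U = M ω (interiorPart U) := by
  filter_upwards [hM.ae_extend_singleton_eq_zero hα hb 0,
    hM.ae_extend_singleton_eq_zero hα hb 1] with ω h0 h1 U
  exact restrict_Icc_apply h0 h1 U

theorem aemeasurable_restrict (hM : IsKarlinLaw P M α b) (hα : 0 < α) (hb : 0 < b) :
    AEMeasurable (fun ω => (M ω).restrict (Set.Icc (0 : ℝ) 1)) P := by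
  refine aemeasurable_of_nullMeasurableSet fun U _ z _ _ => ?_
  refine (hM.nullMeasurableSet_apply_le (interiorPart U) z).congr ?_
  filter_upwards [hM.ae_restrict_apply hα hb] with ω hω
  have h : M ω (interiorPart U) ≤ z ↔ (M ω).restrict (Set.Icc (0 : ℝ) 1) U ≤ z := by rw [hω U]
  exact propext h

open Classical in
theorem cdf_restrict (hM : IsKarlinLaw P M α b) (hα : 0 < α) (hb : 0 < b)
    (s : Finset (Opens (Set.Icc (0 : ℝ) 1) × ℝ≥0∞)) :
    P {ω | ∀ p ∈ s, (M ω).restrict (Set.Icc (0 : ℝ) 1) p.1 ≤ p.2} =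
      P {ω | ∀ p ∈ s.image (Prod.map interiorPart id), M ω p.1 ≤ p.2} := by
  refine measure_congr ?_
  filter_upwards [hM.ae_restrict_apply hα hb] with ω hω
  have h : (∀ p ∈ s, (M ω).restrict (Set.Icc (0 : ℝ) 1) p.1 ≤ p.2) ↔
      ∀ p ∈ s.image (Prod.map interiorPart id), M ω p.1 ≤ p.2 := by
    simp only [Finset.forall_mem_image, Prod.map_fst, Prod.map_snd, id, hω]
  exact propext h

end IsKarlinLaw

theorem IsTest.volume_ne_top {p : Opens ℝ × ℝ≥0∞} (hp : IsTest p) :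
    volume (p.1 : Set ℝ) ≠ ∞ ∧ p.2 ≠ 0 ∧ p.2 ≠ ∞ :=
  ⟨((measure_mono subset_closure).trans_lt hp.1.measure_lt_top).ne, hp.2⟩

open Classical in
theorem volume_ne_top_of_mem_image {s : Finset (Opens (Set.Icc (0 : ℝ) 1) × ℝ≥0∞)}
    (hs : ∀ p ∈ s, IsTest p) :
    ∀ p ∈ s.image (Prod.map interiorPart id),
      volume (p.1 : Set ℝ) ≠ ∞ ∧ p.2 ≠ 0 ∧ p.2 ≠ ∞ := by
  rw [Finset.forall_mem_image]
  exact fun p hp => ⟨volume_interiorPart_ne_top _, (hs p hp).2⟩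

open Classical in
theorem nonempty_activeUnion_image_iff {α γ : ℝ}
    {s : Finset (Opens (Set.Icc (0 : ℝ) 1) × ℝ≥0∞)} :
    (activeUnion α (s.image (Prod.map interiorPart id)) γ : Set ℝ).Nonempty ↔
      (activeUnion α s γ : Set (Set.Icc (0 : ℝ) 1)).Nonempty := by
  simp only [nonempty_activeUnion_iff, Finset.exists_mem_image, Prod.map_fst, Prod.map_snd, id,
    nonempty_interiorPart_iff]

/-! ### Convergence in distribution -/

section Convergence

variable {α : ℝ} {ι : Type*} {l : Filter ι} [l.IsCountablyGenerated] {b : ι → ℝ}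
  {Ω : ι → Type*} [∀ i, MeasurableSpace (Ω i)] {P : ∀ i, Measure (Ω i)}
  [∀ i, IsProbabilityMeasure (P i)] {M : ∀ i, Ω i → SupMeasure ℝ}
  {Ω' : Type*} [MeasurableSpace Ω'] {P' : Measure Ω'} [IsProbabilityMeasure P']

theorem tendstoInDistribution_of_tendsto_one (hα : 0 < α) (hb : ∀ i, 0 < b i ∧ b i ≤ 1)
    (hb1 : Tendsto b l (𝓝 1)) (hM : ∀ i, IsKarlinLaw (P i) (M i) α (b i))
    {M' : Ω' → SupMeasure ℝ} (hM' : IsKarlinLaw P' M' α 1) :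
    TendstoInDistribution M l M' P P' ∧
      TendstoInDistribution (fun i ω => (M i ω).restrict (Set.Icc (0 : ℝ) 1)) l
        (fun ω => (M' ω).restrict (Set.Icc (0 : ℝ) 1)) P P' := by
  classical
  constructor
  · refine tendstoInDistribution_of_tendsto_cdf (fun i => (hM i).aemeasurable) hM'.aemeasurable
      fun s hs => ?_
    have hs' := fun p hp => (hs p hp).volume_ne_top
    rw [hM'.cdf s hs']
    simp only [(hM _).cdf s hs']
    exact tendsto_cdf_of_tendsto_rpow hα hb hs' fun γ _ => tendsto_ofReal_rpow_nhds_one hb1 _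
  · refine tendstoInDistribution_of_tendsto_cdf
      (fun i => (hM i).aemeasurable_restrict hα (hb i).1)
      (hM'.aemeasurable_restrict hα one_pos) fun s hs => ?_
    have hs' := volume_ne_top_of_mem_image hs
    rw [hM'.cdf_restrict hα one_pos, hM'.cdf _ hs']
    simp only [fun i => (hM i).cdf_restrict hα (hb i).1, (hM _).cdf _ hs']
    exact tendsto_cdf_of_tendsto_rpow hα hb hs' fun γ _ => tendsto_ofReal_rpow_nhds_one hb1 _

theorem tendstoInDistribution_of_tendsto_zero (hα : 0 < α) (hb : ∀ i, 0 < b i ∧ b i ≤ 1)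
    (hb0 : Tendsto b l (𝓝 0)) (hM : ∀ i, IsKarlinLaw (P i) (M i) α (b i))
    {Z : Ω' → ℝ} (hZ : IsStandardFrechet P' α Z) :
    TendstoInDistribution M l (fun ω => completelyDependent ℝ (ENNReal.ofReal (Z ω))) P P' ∧
      TendstoInDistribution (fun i ω => (M i ω).restrict (Set.Icc (0 : ℝ) 1)) l
        (fun ω => completelyDependent (Set.Icc (0 : ℝ) 1) (ENNReal.ofReal (Z ω))) P P' := by
  classical
  constructor
  · refine tendstoInDistribution_of_tendsto_cdf (fun i => (hM i).aemeasurable)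
      (aemeasurable_of_nullMeasurableSet fun G _ z _ _ =>
        (measurableSet_completelyDependent_le hZ.measurable G z).nullMeasurableSet)
      fun s hs => ?_
    have hs' := fun p hp => (hs p hp).volume_ne_top
    rw [measure_completelyDependent_le hα hZ fun p hp => (hs p hp).2]
    simp only [(hM _).cdf s hs']
    exact tendsto_cdf_of_tendsto_rpow hα hb hs' fun γ _ =>
      tendsto_ofReal_rpow_nhds_zero hb0 (fun i => (hb i).1) (volume_activeUnion_ne_top hs' α γ)
  · refine tendstoInDistribution_of_tendsto_cdf
      (fun i => (hM i).aemeasurable_restrict hα (hb i).1)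
      (aemeasurable_of_nullMeasurableSet fun G _ z _ _ =>
        (measurableSet_completelyDependent_le hZ.measurable G z).nullMeasurableSet)
      fun s hs => ?_
    have hs' := volume_ne_top_of_mem_image hs
    rw [measure_completelyDependent_le hα hZ fun p hp => (hs p hp).2]
    -- The limit lives on [0,1] and the approximating exponents on ℝ; nonemptiness of the active
    -- union is moved to the interior parts, where lengths are available.
    simp only [fun i => (hM i).cdf_restrict hα (hb i).1, (hM _).cdf _ hs',
      ← nonempty_activeUnion_image_iff (s := s)]
    exact tendsto_cdf_of_tendsto_rpow hα hb hs' fun γ _ =>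
      tendsto_ofReal_rpow_nhds_zero hb0 (fun i => (hb i).1) (volume_activeUnion_ne_top hs' α γ)

end Convergence

end SupMeasure

theorem mainTheorem7
    (α : ℝ) (hα : 0 < α)
    -- the law of the unit-rate Poisson random measure on `ℝ`
    (Pt : Measure (RadonPointMeasure ℝ)) [IsProbabilityMeasure Pt]
    (hPt : IsPoissonRandomMeasure Pt (volume : Measure ℝ) Subtype.val)
    -- for each `β ∈ (0, 1)`, the Poisson point process that represents `M_{α,β}`
    {Ω : Set.Ioo (0 : ℝ) 1 → Type*} [∀ β, MeasurableSpace (Ω β)]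
    (P : ∀ β, Measure (Ω β)) [∀ β, IsProbabilityMeasure (P β)]
    (X : ∀ β, ℕ → Ω β → ℝ × ℝ × RadonPointMeasure ℝ)
    (hX : ∀ β, IsPoissonEnumeration (P β) (karlinIntensity (β : ℝ) Pt) (X β))
    -- the Poisson point process on `(0, ∞) × ℝ` that represents `M_α`
    {Ω₁ : Type*} [MeasurableSpace Ω₁] (P₁ : Measure Ω₁) [IsProbabilityMeasure P₁]
    (Y : ℕ → Ω₁ → ℝ × ℝ)
    (hY : IsPoissonEnumeration P₁
      ((volume.restrict (Set.Ioi (0 : ℝ))).prod (volume : Measure ℝ)) Y)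
    -- the Fréchet variable of the completely dependent sup-measure
    {Ω₀ : Type*} [MeasurableSpace Ω₀] (P₀ : Measure Ω₀) [IsProbabilityMeasure P₀]
    (Z : Ω₀ → ℝ) (hZ : IsStandardFrechet P₀ α Z) :
    -- `β ↑ 1`, in `SM(ℝ)` and in `SM([0,1])`
    (TendstoInDistribution
        (fun β ω => karlinSupMeasure α (fun l => X β l ω))
        (comap Subtype.val (𝓝[<] (1 : ℝ)))
        (fun ω => SupMeasure.scattered α (fun l => Y l ω)) P P₁ ∧
      TendstoInDistribution
        (fun β ω => (karlinSupMeasure α (fun l => X β l ω)).restrict (Set.Icc (0 : ℝ) 1))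
        (comap Subtype.val (𝓝[<] (1 : ℝ)))
        (fun ω => (SupMeasure.scattered α (fun l => Y l ω)).restrict (Set.Icc (0 : ℝ) 1))
        P P₁) ∧
    -- `β ↓ 0`, in `SM(ℝ)` and in `SM([0,1])`
    (TendstoInDistribution
        (fun β ω => karlinSupMeasure α (fun l => X β l ω))
        (comap Subtype.val (𝓝[>] (0 : ℝ)))
        (fun ω => SupMeasure.completelyDependent ℝ (ENNReal.ofReal (Z ω))) P P₀ ∧
      TendstoInDistribution
        (fun β ω => (karlinSupMeasure α (fun l => X β l ω)).restrict (Set.Icc (0 : ℝ) 1))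
        (comap Subtype.val (𝓝[>] (0 : ℝ)))
        (fun ω => SupMeasure.completelyDependent (Set.Icc (0 : ℝ) 1) (ENNReal.ofReal (Z ω)))
        P P₀) := by
  have hb : ∀ β : Set.Ioo (0 : ℝ) 1, 0 < (β : ℝ) ∧ (β : ℝ) ≤ 1 := fun β => ⟨β.2.1, β.2.2.le⟩
  have hM : ∀ β, SupMeasure.IsKarlinLaw (P β)
      (fun ω => karlinSupMeasure α (fun l => X β l ω)) α β :=
    fun β => SupMeasure.isKarlinLaw_karlinSupMeasure hα hPt β.2.1 β.2.2 (hX β)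
  -- The index type already confines β to (0,1), so of the one-sided filters only the convergence of
  -- β to the endpoint is needed.
  exact ⟨SupMeasure.tendstoInDistribution_of_tendsto_one hα hb
      (tendsto_comap.mono_right nhdsWithin_le_nhds) hM (SupMeasure.isKarlinLaw_scattered hα hY),
    SupMeasure.tendstoInDistribution_of_tendsto_zero hα hb
      (tendsto_comap.mono_right nhdsWithin_le_nhds) hM hZ⟩
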